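/- Consider the transformations $a,b,c,d$ of the set $\{0,1\}^\infty$ of infinite binary sequences defined recursively, for $\omega\in\{0,1\}^\infty$, by \begin{align*} a(0\omega)&=1\omega, & a(1\omega)&=0\omega,\\ b(0\omega)&=0\,a(\omega), & b(1\omega)&=1\,c(\omega),\\ c(0\omega)&=0\,a(\omega), & c(1\omega)&=1\,d(\omega),\\ d(0\omega)&=0\omega, & d(1\omega)&=1\,b(\omega). \end{align*} They are permutations (involutions) of $\{0,1\}^\infty$, and the group $\mathfrak G=\langle a,b,c,d\rangle$ that they generate is the first Grigorchuk group. For a finite generating set $S$ of a group $G$, the marked Cayley graph of $(G,S)$ has vertex set $G$ and, for all $g\in G$ and $s\in S$, an edge marked $s$ from $g$ to $gs$; balls are centred at $1$, with edges crossed in either direction. A group $G$ \emph{preforms} a group $H$ if there are a finite generating set $T$ of $H$, a sequence $S_1,S_2,\dots$ of finite generating sets of $G$, and bijections $S_n\to T$, such that for every $R\in\mathbb N$, for all sufficiently large $n$, the balls of radius $R$ in the marked Cayley graphs of $(G,S_n)$ and $(H,T)$ are isomorphic as rooted marked graphs (the marks being identified by $S_n\to T$). The group $G$ has \emph{infinite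 girth} if for every $N$ it has a finite generating set $S$ such that every cycle in the marked Cayley graph of $(G,S)$ has length at least $N$ (equivalently, no non-empty reduced word of length less than $N$ in $S\sqcup S^{-1}$ represents $1$ in $G$). A finitely generated group $G$ has \emph{exponential growth} if $\lim_{R\to\infty}\nu_{G,S}(R)^{1/R}>1$ for some (equivalently, every) finite generating set $S$, where $\nu_{G,S}(R)$ is the number of elements of $G$ that are products of at most $R$ elements of $S\cup S^{-1}$. \textbf{Theorem.} The first Grigorchuk group $\mathfrak G$ preforms the free group $F_3$ of rank $3$. In particular, $\mathfrak G$ has infinite girth. Moreover $\mathfrak G$ does not have exponential growth; consequently Schleimer's conjecture that finitely generated groups of infinite girth have exponential growth is false, even when restricted to groups that are not virtually cyclic (i.e. that have no cyclic subgroup of finite index). -/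

import Mathlib

open Filter Topology

noncomputable section

/-! ### Marked Cayley graphs

For a finite subset `S` of a group `G`, the Cayley graph has vertex set `G` and, for every vertex `g`
and every `s ∈ S`, an edge marked `s` from `g` to `g * s`. A path starting at `1` is a list of letters
`(s, true)` (cross an edge marked `s` forwards) and `(s, false)` (cross it backwards). -/

/-- The endpoint of the path starting at `1` and described by the word `L` in the letters `S ∪ S⁻¹`. -/
def pathEnd {G : Type*} [Group G] (S : Finset G) (L : List (S × Bool)) : G :=
  FreeGroup.lift (fun s : S => (s : G)) (FreeGroup.mk L)

/-- `S` generates the group `G`. -/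
def IsGenerating {G : Type*} [Group G] (S : Finset G) : Prop :=
  Subgroup.closure (S : Set G) = ⊤

/-- The ball of radius `R` around `1` in the Cayley graph of `(G, S)`. -/
def cayleyBall {G : Type*} [Group G] (S : Finset G) (R : ℕ) : Set G :=
  {g | ∃ L : List (S × Bool), L.length ≤ R ∧ pathEnd S L = g}

/-- The balls of radius `R` around `1` in the Cayley graphs of `(G, S)` and `(H, T)` are isomorphic as
rooted graphs with oriented marked edges, the marks `S` and `T` being identified through `e`. -/
def MarkedBallsIso {G H : Type*} [Group G] [Group H] (S : Finset G) (T : Finset H) (e : S ≃ T)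
    (R : ℕ) : Prop :=
  ∃ φ : cayleyBall S R ≃ cayleyBall T R,
    (∀ x : cayleyBall S R, (x : G) = 1 → (φ x : H) = 1) ∧
    ∀ (x y : cayleyBall S R) (s : S), (y : G) = x * s ↔ (φ y : H) = φ x * e s

/-- `G` preforms `H`: for some finite generating set `T` of `H` there are finite generating sets `S n`
of `G`, in bijection with `T`, such that for every `R` the `R`-balls in the marked Cayley graphs of
`(G, S n)` and `(H, T)` are isomorphic for all large `n`. -/
def Preforms (G H : Type*) [Group G] [Group H] : Prop :=
  ∃ T : Finset H, IsGenerating T ∧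
    ∃ S : ℕ → Finset G, (∀ n, IsGenerating (S n)) ∧
      ∃ e : ∀ n, S n ≃ T, ∀ R : ℕ, ∀ᶠ n in atTop, MarkedBallsIso (S n) T (e n) R

/-! ### Girth -/

/-- The girth of the Cayley graph of `(G, S)`: the least length of a non-empty closed path without
backtracking (equivalently, of a cycle; by homogeneity it may be assumed to start at `1`). It is `⊤`
if there is none. -/
def cayleyGirth {G : Type*} [Group G] (S : Finset G) : ℕ∞ :=
  ⨅ (L : List (S × Bool)) (_ : L ≠ [] ∧ FreeGroup.IsReduced L ∧ pathEnd S L = 1), (L.length : ℕ∞)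

/-- The girth of `G`: the supremum of the girths of its Cayley graphs, over all finite generating
sets. -/
def groupGirth (G : Type*) [Group G] : ℕ∞ :=
  ⨆ (S : Finset G) (_ : IsGenerating S), cayleyGirth S

/-- `G` has infinite girth: it has finite generating sets whose Cayley graphs have arbitrarily large
girth. -/
def HasInfiniteGirth (G : Type*) [Group G] : Prop :=
  groupGirth G = ⊤

/-! ### Growth -/

/-- The number of elements of `G` that are products of at most `R` elements of `S ∪ S⁻¹`. -/
def growthFunction {G : Type*} [Group G] (S : Finset G) (R : ℕ) : ℕ :=
  (cayleyBall S R).ncard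

/-- `G` has exponential growth: for some finite generating set `S` (equivalently for all of them, if
`G` is finitely generated), the limit of the `R`-th roots of the growth function exceeds `1`. -/
def HasExponentialGrowth (G : Type*) [Group G] : Prop :=
  ∃ S : Finset G, IsGenerating S ∧ ∃ rate : ℝ, 1 < rate ∧
    Tendsto (fun R : ℕ => (growthFunction S R : ℝ) ^ (1 / (R : ℝ))) atTop (𝓝 rate)

/-- `G` is virtually cyclic: it has a cyclic subgroup of finite index. -/
def IsVirtuallyCyclic (G : Type*) [Group G] : Prop :=
  ∃ C : Subgroup G, IsCyclic C ∧ C.FiniteIndex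

/-! ### The first Grigorchuk group

Infinite binary sequences are functions `ℕ → Bool`, with `false` for the letter `0` and `true` for the
letter `1`. -/

/-- Names of the four generators. -/
inductive GrigGen : Type
  | a | b | c | d

/-- The sequence without its first letter. -/
def seqTail (ω : ℕ → Bool) : ℕ → Bool := fun n => ω (n + 1)

/-- The sequence `x ω`, with `x` put in front. -/
def seqCons (x : Bool) (ω : ℕ → Bool) : ℕ → Bool
  | 0 => x
  | n + 1 => ω n

/-- The transformations `a, b, c, d` of the binary sequences, letter by letter. They are characterised
by the recursive formulas in the lemmas `grigAct_a_cons` to `grigAct_d_cons` below. -/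
def grigAct : GrigGen → (ℕ → Bool) → ℕ → Bool
  | .a, ω, 0 => !(ω 0)
  | .a, ω, n + 1 => ω (n + 1)
  | .b, ω, 0 => ω 0
  | .b, ω, n + 1 => bif ω 0 then grigAct .c (seqTail ω) n else grigAct .a (seqTail ω) n
  | .c, ω, 0 => ω 0
  | .c, ω, n + 1 => bif ω 0 then grigAct .d (seqTail ω) n else grigAct .a (seqTail ω) n
  | .d, ω, 0 => ω 0
  | .d, ω, n + 1 => bif ω 0 then grigAct .b (seqTail ω) n else seqTail ω n

theorem grigAct_a_cons (x : Bool) (ω : ℕ → Bool) :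
    grigAct .a (seqCons x ω) = seqCons (!x) ω := by
  funext n; cases n <;> simp [grigAct, seqCons]

theorem grigAct_b_cons (ω : ℕ → Bool) :
    grigAct .b (seqCons false ω) = seqCons false (grigAct .a ω) ∧
    grigAct .b (seqCons true ω) = seqCons true (grigAct .c ω) := by
  constructor <;> funext n <;> cases n <;> rfl

theorem grigAct_c_cons (ω : ℕ → Bool) :
    grigAct .c (seqCons false ω) = seqCons false (grigAct .a ω) ∧
    grigAct .c (seqCons true ω) = seqCons true (grigAct .d ω) := by
  constructor <;> funext n <;> cases n <;> rfl

theorem grigAct_d_cons (ω : ℕ → Bool) :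
    grigAct .d (seqCons false ω) = seqCons false ω ∧
    grigAct .d (seqCons true ω) = seqCons true (grigAct .b ω) := by
  constructor <;> funext n <;> cases n <;> rfl

theorem seqCons_head_tail (ω : ℕ → Bool) : seqCons (ω 0) (seqTail ω) = ω := by
  funext n; cases n <;> rfl

theorem grigAct_involutive (g : GrigGen) : Function.Involutive (grigAct g) := by
  intro ω
  funext n
  induction n generalizing g ω with
  | zero => cases g <;> simp [grigAct]
  | succ n ih =>
    rw [← seqCons_head_tail ω]
    generalize ω 0 = x
    generalize seqTail ω = ω'
    cases g <;> cases x <;>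
      simp [grigAct_a_cons, grigAct_b_cons, grigAct_c_cons, grigAct_d_cons] <;>
      simp [seqCons, ih]

/-- The generators as permutations of the set of binary sequences. -/
def grigPerm (g : GrigGen) : Equiv.Perm (ℕ → Bool) :=
  (grigAct_involutive g).toPerm

/-- The first Grigorchuk group: the group of permutations of `{0,1}^∞` generated by `a, b, c, d`. -/
def grigorchukGroup : Subgroup (Equiv.Perm (ℕ → Bool)) :=
  Subgroup.closure (Set.range grigPerm)

end

open scoped commutatorElement

/-! ### Permutations acting on the two halves of the tree -/

/-! It suffices to find, for every `R`, three generators without reduced relations of length at most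
`R`: small balls are then balls of a free group. The group is regular branch over a subgroup K
generated by (ab)² and its two copies one level down: K is normal, contains K × K
(`pair_mem_branchK`), and lies in the commutator subgroup. The triple is obtained by multiplying a,
b, d by elements of K.

Absence of short relations: K has elements supported in arbitrarily small cylinders around any
point, so the letters can be altered along trajectories until every short reduced word moves a point
(`exists_generic_tuple`). This fixes only finitely many values, all outside the orbit of ξ = 000…,
and the alterations are trivial near ξ, aξ and bξ. On the cylinder of a long prefix v of ξ there is
thus room to plant the three generators of K; these reappear as sections at v of the squares of the
first two letters and of the third letter itself.

Generation: modulo the block subgroups Kₙ (copies of K at all vertices of level n) the group is a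
finite 2-group, and K consists of products of commutators, so by the Frattini argument the new
triple generates a dense subgroup H (`dense_of_generators`). Density and the planted sections make
every element of the group a section of H at v. Such an H is everything
(`IsLevelDense.eq_grigorchukGroup`): commutators squeeze an element of H down to a single vertex,
and a non-trivial normal subgroup contains some Kₘ (`exists_levelSubgroup_le`).

Growth: for suitable weights of the generators, the two sections of an element have total weight at
most 5/6 of its own, up to a constant. A bound exp(tr) on the growth therefore improves to
exp(11tr/12), and iteration brings the rate below any positive number (`growthBound_of_pos`). -/

theorem seqCons_zero (x : Bool) (ω : ℕ → Bool) : seqCons x ω 0 = x := rfl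

theorem seqTail_seqCons (x : Bool) (ω : ℕ → Bool) : seqTail (seqCons x ω) = ω := rfl

theorem exists_eq_seqCons (ω : ℕ → Bool) : ∃ x ω', ω = seqCons x ω' :=
  ⟨ω 0, seqTail ω, (seqCons_head_tail ω).symm⟩

theorem seqCons_injective {x y : Bool} {ω ω' : ℕ → Bool} (h : seqCons x ω = seqCons y ω') :
    x = y ∧ ω = ω' :=
  ⟨congrFun h 0, by simpa [seqTail_seqCons] using congrArg seqTail h⟩

/-- Two permutations of the set of sequences agree if they agree on all `xω`. -/
theorem perm_ext_cons {g h : Equiv.Perm (ℕ → Bool)}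
    (H : ∀ x ω, g (seqCons x ω) = h (seqCons x ω)) : g = h := by
  ext1 ω
  obtain ⟨x, ω', rfl⟩ := exists_eq_seqCons ω
  exact H x ω'

/-- The permutation `xω ↦ x (f x ω)`. -/
noncomputable def pairHom : (Bool → Equiv.Perm (ℕ → Bool)) →* Equiv.Perm (ℕ → Bool) where
  toFun f :=
    { toFun := fun ω => seqCons (ω 0) (f (ω 0) (seqTail ω))
      invFun := fun ω => seqCons (ω 0) ((f (ω 0))⁻¹ (seqTail ω))
      left_inv := fun ω => by simp [seqCons_zero, seqTail_seqCons, seqCons_head_tail]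
      right_inv := fun ω => by simp [seqCons_zero, seqTail_seqCons, seqCons_head_tail] }
  map_one' := by ext1 ω; exact seqCons_head_tail ω
  map_mul' f g := rfl

@[simp]
theorem pairHom_cons (f : Bool → Equiv.Perm (ℕ → Bool)) (x : Bool) (ω : ℕ → Bool) :
    pairHom f (seqCons x ω) = seqCons x (f x ω) := rfl

/-- The permutation acting as `g` below `0` and as `h` below `1`. -/
noncomputable def pair (g h : Equiv.Perm (ℕ → Bool)) : Equiv.Perm (ℕ → Bool) :=
  pairHom fun x => bif x then h else g

theorem pairHom_eq_pair (f : Bool → Equiv.Perm (ℕ → Bool)) : pairHom f = pair (f false) (f true) := by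
  unfold pair
  congr 1
  funext x
  cases x <;> rfl

@[simp]
theorem pair_false (g h : Equiv.Perm (ℕ → Bool)) (ω : ℕ → Bool) :
    pair g h (seqCons false ω) = seqCons false (g ω) := rfl

@[simp]
theorem pair_true (g h : Equiv.Perm (ℕ → Bool)) (ω : ℕ → Bool) :
    pair g h (seqCons true ω) = seqCons true (h ω) := rfl

theorem pair_mul (g h g' h' : Equiv.Perm (ℕ → Bool)) :
    pair g h * pair g' h' = pair (g * g') (h * h') := by
  unfold pair
  rw [← map_mul]
  congr 1
  funext x
  cases x <;> rfl

theorem pair_inv (g h : Equiv.Perm (ℕ → Bool)) : (pair g h)⁻¹ = pair g⁻¹ h⁻¹ := by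
  unfold pair
  rw [← map_inv]
  congr 1
  funext x
  cases x <;> rfl

theorem pair_one : pair 1 1 = 1 := by
  unfold pair
  refine Eq.trans (congrArg pairHom (a₂ := 1) (funext fun x => ?_)) (map_one pairHom)
  cases x <;> rfl

/-! ### Relations between the generators -/

/-- The generator `a` as a permutation. -/
noncomputable abbrev gA : Equiv.Perm (ℕ → Bool) := grigPerm .a
/-- The generator `b` as a permutation. -/
noncomputable abbrev gB : Equiv.Perm (ℕ → Bool) := grigPerm .b
/-- The generator `c` as a permutation. -/
noncomputable abbrev gC : Equiv.Perm (ℕ → Bool) := grigPerm .c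
/-- The generator `d` as a permutation. -/
noncomputable abbrev gD : Equiv.Perm (ℕ → Bool) := grigPerm .d

theorem grigPerm_apply (g : GrigGen) (ω : ℕ → Bool) : grigPerm g ω = grigAct g ω := rfl

@[simp]
theorem gA_cons (x : Bool) (ω : ℕ → Bool) : gA (seqCons x ω) = seqCons (!x) ω := grigAct_a_cons x ω

theorem gB_eq : gB = pair gA gC := by
  apply perm_ext_cons
  rintro (_ | _) ω
  · exact (grigAct_b_cons ω).1
  · exact (grigAct_b_cons ω).2

theorem gC_eq : gC = pair gA gD := by
  apply perm_ext_cons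
  rintro (_ | _) ω
  · exact (grigAct_c_cons ω).1
  · exact (grigAct_c_cons ω).2

theorem gD_eq : gD = pair 1 gB := by
  apply perm_ext_cons
  rintro (_ | _) ω
  · exact (grigAct_d_cons ω).1
  · exact (grigAct_d_cons ω).2

theorem grigPerm_mul_self (g : GrigGen) : grigPerm g * grigPerm g = 1 := by
  ext1 ω
  exact grigAct_involutive g ω

theorem grigPerm_inv (g : GrigGen) : (grigPerm g)⁻¹ = grigPerm g :=
  inv_eq_of_mul_eq_one_left (grigPerm_mul_self g)

theorem gA_inv : gA⁻¹ = gA := grigPerm_inv _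
theorem gB_inv : gB⁻¹ = gB := grigPerm_inv _
theorem gC_inv : gC⁻¹ = gC := grigPerm_inv _
theorem gD_inv : gD⁻¹ = gD := grigPerm_inv _
theorem gA_mul_self : gA * gA = 1 := grigPerm_mul_self _
theorem gB_mul_self : gB * gB = 1 := grigPerm_mul_self _
theorem gC_mul_self : gC * gC = 1 := grigPerm_mul_self _
theorem gD_mul_self : gD * gD = 1 := grigPerm_mul_self _

theorem gA_mul_pair (g h : Equiv.Perm (ℕ → Bool)) : gA * pair g h = pair h g * gA := by
  apply perm_ext_cons
  rintro (_ | _) ω <;> simp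

theorem gA_conj_pair (g h : Equiv.Perm (ℕ → Bool)) : gA * pair g h * gA = pair h g := by
  rw [gA_mul_pair, mul_assoc, grigPerm_mul_self, mul_one]

/-- The products bc, cd, db have sections (1, cd), (a, db), (a, bc), the same pattern as d = (1, b),
b = (a, c), c = (a, d). So the three identities reduce to one another one letter further on and are
proved together, position by position. -/
theorem gB_mul_gC : gB * gC = gD := by
  have key : ∀ (n : ℕ) (ω : ℕ → Bool), (gB * gC) ω n = gD ω n ∧ (gC * gD) ω n = gB ω n ∧
      (gD * gB) ω n = gC ω n := by
    intro n
    induction n with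
    | zero =>
      intro ω
      obtain ⟨x, ω', rfl⟩ := exists_eq_seqCons ω
      rw [gB_eq, gC_eq, gD_eq]
      cases x <;> simp [seqCons]
    | succ n ih =>
      intro ω
      obtain ⟨x, ω', rfl⟩ := exists_eq_seqCons ω
      have e1 : gB * gC = pair 1 (gC * gD) := by
        nth_rw 1 [gB_eq]; nth_rw 2 [gC_eq]; rw [pair_mul, gA_mul_self]
      have e2 : gC * gD = pair gA (gD * gB) := by
        nth_rw 1 [gC_eq]; nth_rw 2 [gD_eq]; rw [pair_mul, mul_one]
      have e3 : gD * gB = pair gA (gB * gC) := by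
        nth_rw 1 [gD_eq]; nth_rw 2 [gB_eq]; rw [pair_mul, one_mul]
      have b1 := congrArg (fun p => p (seqCons x ω')) gB_eq
      have c1 := congrArg (fun p => p (seqCons x ω')) gC_eq
      have d1 := congrArg (fun p => p (seqCons x ω')) gD_eq
      refine ⟨?_, ?_, ?_⟩
      · rw [e1, d1]
        cases x
        · rfl
        · exact (ih ω').2.1
      · rw [e2, b1]
        cases x
        · rfl
        · exact (ih ω').2.2
      · rw [e3, c1]
        cases x
        · rfl
        · exact (ih ω').1
  ext1 ω
  funext n
  exact (key n ω).1

theorem gC_mul_gB : gC * gB = gD := by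
  rw [← gB_inv, ← gC_inv, ← mul_inv_rev, gB_mul_gC, gD_inv]

theorem gB_mul_gD : gB * gD = gC := by
  rw [← gB_mul_gC, ← mul_assoc, grigPerm_mul_self, one_mul]

theorem gD_mul_gB : gD * gB = gC := by
  rw [← gC_mul_gB, mul_assoc, grigPerm_mul_self, mul_one]

theorem gC_mul_gD : gC * gD = gB := by
  rw [← gC_mul_gB, ← mul_assoc, grigPerm_mul_self, one_mul]

theorem gD_mul_gC : gD * gC = gB := by
  rw [← gB_mul_gC, mul_assoc, grigPerm_mul_self, mul_one]

theorem gA_mul_cancel (g : Equiv.Perm (ℕ → Bool)) : gA * (gA * g) = g := by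
  rw [← mul_assoc, grigPerm_mul_self, one_mul]

theorem gD_mul_gB_mul (g : Equiv.Perm (ℕ → Bool)) : gD * (gB * g) = gC * g := by
  rw [← mul_assoc, gD_mul_gB]

theorem gC_mul_gD_mul (g : Equiv.Perm (ℕ → Bool)) : gC * (gD * g) = gB * g := by
  rw [← mul_assoc, gC_mul_gD]

/-! ### The branching subgroup -/

/-- The element `(ab)²`. -/
noncomputable def gT : Equiv.Perm (ℕ → Bool) := gA * gB * gA * gB

theorem gT_inv : gT⁻¹ = gB * gA * gB * gA := by
  simp only [gT, mul_inv_rev, gA_inv, gB_inv, mul_assoc]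

theorem gT_eq : gT = pair (gC * gA) (gA * gC) := by
  rw [gT]
  conv_lhs => rw [gB_eq, gA_conj_pair, pair_mul]

theorem gA_conj_gT : gA * gT * gA = gT⁻¹ := by
  simp only [gT_inv]; simp only [gT, mul_assoc, gA_mul_cancel]

theorem gB_conj_gT : gB * gT * gB = gT⁻¹ := by
  simp only [gT_inv]; simp only [gT, mul_assoc, gB_mul_self, mul_one]

/-- Equivalently, the commutator of d and (ab)² is the copy of (ab)⁻² below 1. This is how a normal
subgroup containing (ab)² acquires its copies on the next level. -/
theorem gD_conj_gT : gD * gT * gD = pair 1 gT⁻¹ * gT := by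
  have h : gB * (gA * gC) * gB = gT⁻¹ * (gA * gC) := by
    simp only [gT_inv, mul_assoc, gA_mul_cancel, gB_mul_gC, gC_mul_gB]
  calc gD * gT * gD = pair 1 gB * pair (gC * gA) (gA * gC) * pair 1 gB := by
        rw [← gT_eq, ← gD_eq]
    _ = pair 1 gT⁻¹ * pair (gC * gA) (gA * gC) := by
        rw [pair_mul, pair_mul, pair_mul, h, one_mul, mul_one]
    _ = pair 1 gT⁻¹ * gT := by rw [← gT_eq]

/-- The branching subgroup `K` of the Grigorchuk group, generated by `(ab)²` and its copies below `0`
and below `1`. -/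
noncomputable def branchK : Subgroup (Equiv.Perm (ℕ → Bool)) :=
  Subgroup.closure {gT, pair gT 1, pair 1 gT}

theorem gT_mem : gT ∈ branchK := Subgroup.subset_closure (by simp)

theorem pair_gT_one_mem : pair gT 1 ∈ branchK := Subgroup.subset_closure (by simp)

theorem pair_one_gT_mem : pair 1 gT ∈ branchK := Subgroup.subset_closure (by simp)

/-- An involution normalises the closure of a set as soon as it maps the set into the closure. -/
theorem conj_mem_closure {G : Type*} [Group G] {S : Set G} {s : G} (hs : s * s = 1)
    (h : ∀ x ∈ S, s * x * s ∈ Subgroup.closure S) {g : G} (hg : g ∈ Subgroup.closure S) :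
    s * g * s ∈ Subgroup.closure S := by
  have hinv : s⁻¹ = s := inv_eq_of_mul_eq_one_left hs
  induction hg using Subgroup.closure_induction with
  | mem x hx => exact h x hx
  | one => simp [hs, one_mem]
  | mul x y _ _ hx hy =>
    have : s * (x * y) * s = (s * x * s) * (s * y * s) := by
      simp only [mul_assoc]
      rw [← mul_assoc s s, hs, one_mul]
    rw [this]
    exact mul_mem hx hy
  | inv x _ hx =>
    have : s * x⁻¹ * s = (s * x * s)⁻¹ := by simp [mul_assoc, hinv]
    rw [this]
    exact inv_mem hx

theorem gC_conj_gT : gC * gT * gC = gT⁻¹ * pair 1 gT := by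
  have : gC * gT * gC = gD * (gB * gT * gB) * gD := by
    simp only [mul_assoc, gB_mul_gD, gD_mul_gB_mul]
  rw [this, gB_conj_gT]
  have h2 : gD * gT⁻¹ * gD = (gD * gT * gD)⁻¹ := by simp only [mul_inv_rev, mul_assoc, gD_inv]
  rw [h2, gD_conj_gT, mul_inv_rev, pair_inv]
  simp

theorem gA_conj_branchK {g : Equiv.Perm (ℕ → Bool)} (hg : g ∈ branchK) : gA * g * gA ∈ branchK := by
  refine conj_mem_closure (grigPerm_mul_self _) ?_ hg
  rintro x (rfl | rfl | rfl)
  · rw [gA_conj_gT]; exact inv_mem gT_mem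
  · rw [gA_conj_pair]; exact pair_one_gT_mem
  · rw [gA_conj_pair]; exact pair_gT_one_mem

theorem gD_conj_branchK {g : Equiv.Perm (ℕ → Bool)} (hg : g ∈ branchK) : gD * g * gD ∈ branchK := by
  refine conj_mem_closure (grigPerm_mul_self _) ?_ hg
  rintro x (rfl | rfl | rfl)
  · rw [gD_conj_gT, ← inv_one, ← pair_inv]; exact mul_mem (inv_mem pair_one_gT_mem) gT_mem
  · have : gD * pair gT 1 * gD = pair gT 1 := by
      conv_lhs => rw [gD_eq, pair_mul, pair_mul]
      simp only [one_mul, mul_one, gB_mul_self]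
    rw [this]; exact pair_gT_one_mem
  · have : gD * pair 1 gT * gD = (pair 1 gT)⁻¹ := by
      conv_lhs => rw [gD_eq, pair_mul, pair_mul, gB_conj_gT]
      rw [pair_inv, inv_one, one_mul, mul_one]
    rw [this]; exact inv_mem pair_one_gT_mem

/-- Below 1, (ab)² acts as ac, so conjugating the copy of (ab)² there amounts to conjugating (ab)²
by ac. Dividing by the copy itself leaves a second-level copy; the conjugation in the other
direction gives the other one. -/
theorem gT_conj_pair_one_gT : gT * pair 1 gT * gT⁻¹ = pair 1 (gT * pair gT 1) := by
  have e : gA * gC * gT * (gA * gC)⁻¹ = gT * pair gT 1 := by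
    have h1 : gA * gC * gT * (gA * gC)⁻¹ = gA * (gC * gT * gC) * gA := by
      simp only [mul_inv_rev, mul_assoc, gA_inv, gC_inv]
    have h2 : gA * (gT⁻¹ * pair 1 gT) * gA = (gA * gT * gA)⁻¹ * (gA * pair 1 gT * gA) := by
      simp only [mul_inv_rev, mul_assoc, gA_inv, gA_mul_cancel]
    rw [h1, gC_conj_gT, h2, gA_conj_gT, gA_conj_pair, inv_inv]
  calc gT * pair 1 gT * gT⁻¹
      = pair (gC * gA) (gA * gC) * pair 1 gT * (pair (gC * gA) (gA * gC))⁻¹ := by rw [← gT_eq]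
    _ = pair 1 (gT * pair gT 1) := by
      rw [pair_inv, pair_mul, pair_mul, e, mul_one, mul_inv_cancel]

theorem gT_inv_conj_pair_one_gT : gT⁻¹ * pair 1 gT * gT = pair 1 ((pair 1 gT)⁻¹ * gT) := by
  have e : (gA * gC)⁻¹ * gT * (gA * gC) = (pair 1 gT)⁻¹ * gT := by
    have h1 : (gA * gC)⁻¹ * gT * (gA * gC) = gC * (gA * gT * gA) * gC := by
      simp only [mul_inv_rev, mul_assoc, gA_inv, gC_inv]
    have h2 : gC * gT⁻¹ * gC = (gC * gT * gC)⁻¹ := by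
      simp only [mul_inv_rev, mul_assoc, gC_inv]
    rw [h1, gA_conj_gT, h2, gC_conj_gT, mul_inv_rev, inv_inv]
  calc gT⁻¹ * pair 1 gT * gT
      = (pair (gC * gA) (gA * gC))⁻¹ * pair 1 gT * pair (gC * gA) (gA * gC) := by rw [← gT_eq]
    _ = pair 1 ((pair 1 gT)⁻¹ * gT) := by
      rw [pair_inv, pair_mul, pair_mul, e, mul_one, inv_mul_cancel]

/-- The branching property. Only the copies below 1 of the generators of K need an argument: the
first is itself a generator, the other two come from conjugating it by (ab)² and by its inverse. -/
theorem pair_one_mem_branchK {g : Equiv.Perm (ℕ → Bool)} (hg : g ∈ branchK) :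
    pair 1 g ∈ branchK := by
  induction hg using Subgroup.closure_induction with
  | mem x hx =>
    rcases hx with rfl | rfl | rfl
    · exact pair_one_gT_mem
    · have h : gT * pair 1 gT * gT⁻¹ ∈ branchK :=
        mul_mem (mul_mem gT_mem pair_one_gT_mem) (inv_mem gT_mem)
      rw [gT_conj_pair_one_gT] at h
      have := mul_mem (inv_mem pair_one_gT_mem) h
      rwa [pair_inv, pair_mul, inv_one, one_mul, inv_mul_cancel_left] at this
    · have h : gT⁻¹ * pair 1 gT * gT ∈ branchK :=
        mul_mem (mul_mem (inv_mem gT_mem) pair_one_gT_mem) gT_mem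
      rw [gT_inv_conj_pair_one_gT] at h
      have := mul_mem pair_one_gT_mem (inv_mem h)
      rwa [pair_inv, pair_mul, inv_one, one_mul, mul_inv_rev, inv_inv, mul_inv_cancel_left] at this
  | one => rw [pair_one]; exact one_mem _
  | mul x y _ _ hx hy =>
    have := mul_mem hx hy
    rwa [pair_mul, one_mul] at this
  | inv x _ hx =>
    have := inv_mem hx
    rwa [pair_inv, inv_one] at this

theorem pair_mem_branchK {g h : Equiv.Perm (ℕ → Bool)} (hg : g ∈ branchK) (hh : h ∈ branchK) :
    pair g h ∈ branchK := by
  have h1 := gA_conj_branchK (pair_one_mem_branchK hg)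
  rw [gA_conj_pair] at h1
  have := mul_mem h1 (pair_one_mem_branchK hh)
  rwa [pair_mul, one_mul, mul_one] at this

theorem pairHom_mem_branchK {f : Bool → Equiv.Perm (ℕ → Bool)} (hf : ∀ x, f x ∈ branchK) :
    pairHom f ∈ branchK := by
  rw [pairHom_eq_pair]
  exact pair_mem_branchK (hf _) (hf _)

/-- Conjugating the copy below 1 by b conjugates by c inside it, which produces a second-level copy;
hence the dependence on the branching property. -/
theorem gB_conj_branchK {g : Equiv.Perm (ℕ → Bool)} (hg : g ∈ branchK) : gB * g * gB ∈ branchK := by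
  have hc : gC * gT * gC ∈ branchK := by
    rw [gC_conj_gT]; exact mul_mem (inv_mem gT_mem) pair_one_gT_mem
  refine conj_mem_closure gB_mul_self ?_ hg
  rintro x (rfl | rfl | rfl)
  · rw [gB_conj_gT]; exact inv_mem gT_mem
  · have : gB * pair gT 1 * gB = pair gT⁻¹ 1 := by
      conv_lhs => rw [gB_eq, pair_mul, pair_mul, gA_conj_gT]
      rw [mul_one, gC_mul_self]
    rw [this]; exact pair_mem_branchK (inv_mem gT_mem) (one_mem _)
  · have : gB * pair 1 gT * gB = pair 1 (gC * gT * gC) := by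
      conv_lhs => rw [gB_eq, pair_mul, pair_mul]
      rw [mul_one, gA_mul_self]
    rw [this]; exact pair_one_mem_branchK hc

theorem grigPerm_conj_branchK (s : GrigGen) {g : Equiv.Perm (ℕ → Bool)} (hg : g ∈ branchK) :
    grigPerm s * g * grigPerm s ∈ branchK := by
  cases s with
  | a => exact gA_conj_branchK hg
  | b => exact gB_conj_branchK hg
  | d => exact gD_conj_branchK hg
  | c =>
    have : gC * g * gC = gD * (gB * g * gB) * gD := by
      simp only [mul_assoc, gB_mul_gD, gD_mul_gB_mul]
    show gC * g * gC ∈ _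
    rw [this]
    exact gD_conj_branchK (gB_conj_branchK hg)

theorem grigPerm_mem (s : GrigGen) : grigPerm s ∈ grigorchukGroup :=
  Subgroup.subset_closure ⟨s, rfl⟩

/-- Induction over words in the generators. -/
theorem grig_induction {p : Equiv.Perm (ℕ → Bool) → Prop} (one : p 1)
    (mul : ∀ s, ∀ g ∈ grigorchukGroup, p g → p (grigPerm s * g)) {g : Equiv.Perm (ℕ → Bool)}
    (hg : g ∈ grigorchukGroup) : p g := by
  induction hg using Subgroup.closure_induction_left with
  | one => exact one
  | mul_left x hx y hy h =>
    obtain ⟨s, rfl⟩ := hx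
    exact mul s y hy h
  | inv_mul_cancel x hx y hy h =>
    obtain ⟨s, rfl⟩ := hx
    rw [grigPerm_inv]
    exact mul s y hy h

/-- A subgroup that is normalised by the generators is normalised by the Grigorchuk group. -/
theorem conj_mem_of_grigPerm {L : Subgroup (Equiv.Perm (ℕ → Bool))}
    (hL : ∀ s, ∀ x ∈ L, grigPerm s * x * grigPerm s ∈ L) {g : Equiv.Perm (ℕ → Bool)}
    (hg : g ∈ grigorchukGroup) : ∀ x ∈ L, g * x * g⁻¹ ∈ L := by
  refine grig_induction (p := fun g => ∀ x ∈ L, g * x * g⁻¹ ∈ L) (by simp) ?_ hg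
  intro s g _ h x hx
  have := hL s _ (h x hx)
  rwa [mul_inv_rev, grigPerm_inv, mul_assoc, mul_assoc, ← mul_assoc x, ← mul_assoc g,
    ← mul_assoc, ← mul_assoc (grigPerm s)] at *

theorem conj_mem_branchK {g k : Equiv.Perm (ℕ → Bool)} (hg : g ∈ grigorchukGroup)
    (hk : k ∈ branchK) : g * k * g⁻¹ ∈ branchK :=
  conj_mem_of_grigPerm (fun s _ hx => grigPerm_conj_branchK s hx) hg k hk

theorem gT_eq_commutator : gT = ⁅gA, gB⁆ := by
  rw [commutatorElement_def, gA_inv, gB_inv, gT]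

/-- Since b = (a, c) and ada = (b, 1), the second coordinates cancel and the first give [a, b]. -/
theorem pair_gT_one_eq_commutator : pair gT 1 = ⁅gB, gA * gD * gA⁆ := by
  have h2 : gA * gD * gA = pair gB 1 := by conv_lhs => rw [gD_eq, gA_conj_pair]
  rw [h2, commutatorElement_def]
  nth_rw 1 [gB_eq]
  nth_rw 2 [gB_eq]
  rw [pair_inv, pair_inv, pair_mul, pair_mul, pair_mul, inv_one, mul_one, mul_one, mul_inv_cancel,
    ← commutatorElement_def, gT_eq_commutator]

theorem gT_mem_grig : gT ∈ grigorchukGroup :=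
  mul_mem (mul_mem (mul_mem (grigPerm_mem _) (grigPerm_mem _)) (grigPerm_mem _)) (grigPerm_mem _)

theorem pair_gT_one_mem_grig : pair gT 1 ∈ grigorchukGroup := by
  rw [pair_gT_one_eq_commutator, commutatorElement_def]
  have ha := grigPerm_mem .a
  have hb := grigPerm_mem .b
  have hd := grigPerm_mem .d
  have h := mul_mem (mul_mem ha hd) ha
  exact mul_mem (mul_mem (mul_mem hb h) (inv_mem hb)) (inv_mem h)

theorem branchK_le : branchK ≤ grigorchukGroup := by
  refine (Subgroup.closure_le _).2 ?_
  rintro x (rfl | rfl | rfl)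
  · exact gT_mem_grig
  · exact pair_gT_one_mem_grig
  · rw [← gA_conj_pair]
    exact mul_mem (mul_mem (grigPerm_mem _) pair_gT_one_mem_grig) (grigPerm_mem _)

/-- Every element of `K` is a product of commutators of the Grigorchuk group. -/
theorem branchK_le_commutator : branchK ≤ ⁅grigorchukGroup, grigorchukGroup⁆ := by
  have h2 : pair gT 1 ∈ ⁅grigorchukGroup, grigorchukGroup⁆ := by
    rw [pair_gT_one_eq_commutator]
    exact Subgroup.commutator_mem_commutator (grigPerm_mem .b)
      (mul_mem (mul_mem (grigPerm_mem .a) (grigPerm_mem .d)) (grigPerm_mem .a))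
  refine (Subgroup.closure_le _).2 ?_
  rintro x (rfl | rfl | rfl)
  · rw [gT_eq_commutator]
    exact Subgroup.commutator_mem_commutator (grigPerm_mem .a) (grigPerm_mem .b)
  · exact h2
  · have : pair 1 gT = ⁅gA, pair gT 1⁆ * pair gT 1 := by
      rw [commutatorElement_def, gA_inv, gA_conj_pair, inv_mul_cancel_right]
    rw [this]
    exact mul_mem (Subgroup.commutator_mem_commutator (grigPerm_mem .a) pair_gT_one_mem_grig) h2

/-! ### Vertices of the tree and block-diagonal permutations -/

/-- The sequence `vω`. -/
def prepend {n : ℕ} (v : Fin n → Bool) (ω : ℕ → Bool) : ℕ → Bool :=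
  fun i => if h : i < n then v ⟨i, h⟩ else ω (i - n)

/-- The first `n` letters. -/
def seqInit (n : ℕ) (ω : ℕ → Bool) : Fin n → Bool := fun i => ω i

/-- The sequence without its first `n` letters. -/
def seqDrop (n : ℕ) (ω : ℕ → Bool) : ℕ → Bool := fun i => ω (i + n)

@[simp]
theorem prepend_init_drop (n : ℕ) (ω : ℕ → Bool) : prepend (seqInit n ω) (seqDrop n ω) = ω := by
  funext i
  by_cases h : i < n
  · simp [prepend, seqInit, h]
  · simp [prepend, seqDrop, h, Nat.sub_add_cancel (not_lt.1 h)]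

@[simp]
theorem seqInit_prepend {n : ℕ} (v : Fin n → Bool) (ω : ℕ → Bool) : seqInit n (prepend v ω) = v := by
  funext i
  simp [prepend, seqInit]

@[simp]
theorem seqDrop_prepend {n : ℕ} (v : Fin n → Bool) (ω : ℕ → Bool) : seqDrop n (prepend v ω) = ω := by
  funext i
  simp [prepend, seqDrop]

theorem prepend_injective {n : ℕ} {v v' : Fin n → Bool} {ω ω' : ℕ → Bool}
    (h : prepend v ω = prepend v' ω') : v = v' ∧ ω = ω' :=
  ⟨by simpa using congrArg (seqInit n) h, by simpa using congrArg (seqDrop n) h⟩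

theorem exists_eq_prepend (n : ℕ) (ω : ℕ → Bool) : ∃ (v : Fin n → Bool) (ω' : ℕ → Bool),
    ω = prepend v ω' := ⟨_, _, (prepend_init_drop n ω).symm⟩

theorem prepend_zero (v : Fin 0 → Bool) (ω : ℕ → Bool) : prepend v ω = ω := by
  funext i
  simp [prepend]

theorem prepend_cons {n : ℕ} (x : Bool) (v : Fin n → Bool) (ω : ℕ → Bool) :
    prepend (Fin.cons x v : Fin (n + 1) → Bool) ω = seqCons x (prepend v ω) := by
  funext i
  cases i with
  | zero => rfl
  | succ i =>
    by_cases h : i < n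
    · have : (⟨i + 1, Nat.succ_lt_succ h⟩ : Fin (n + 1)) = Fin.succ ⟨i, h⟩ := rfl
      simp [prepend, seqCons, h, this, -Fin.succ_mk]
    · simp [prepend, seqCons, h]

theorem prepend_append {n m : ℕ} (v : Fin n → Bool) (u : Fin m → Bool) (ω : ℕ → Bool) :
    prepend (Fin.append v u) ω = prepend v (prepend u ω) := by
  funext i
  by_cases h : i < n
  · have : (⟨i, by omega⟩ : Fin (n + m)) = Fin.castAdd m ⟨i, h⟩ := rfl
    simp only [prepend, h, show i < n + m by omega, dif_pos, this, Fin.append_left]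
  · by_cases h2 : i < n + m
    · have : (⟨i, h2⟩ : Fin (n + m)) = Fin.natAdd n ⟨i - n, by omega⟩ := by
        ext; simp; omega
      simp only [prepend, h, h2, show i - n < m by omega, dif_pos, dif_neg, not_false_eq_true, this,
        Fin.append_right]
    · simp only [prepend, h, h2, show ¬ i - n < m by omega, dif_neg, not_false_eq_true]
      congr 1
      omega

theorem perm_ext_prepend (n : ℕ) {g h : Equiv.Perm (ℕ → Bool)}
    (H : ∀ (v : Fin n → Bool) (ω), g (prepend v ω) = h (prepend v ω)) : g = h := by
  ext1 ω
  rw [← prepend_init_drop n ω]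
  exact H _ _

/-- The permutation `vω ↦ v (f v ω)`, for `v` of length `n`. -/
noncomputable def blockHom (n : ℕ) :
    ((Fin n → Bool) → Equiv.Perm (ℕ → Bool)) →* Equiv.Perm (ℕ → Bool) where
  toFun f :=
    { toFun := fun ω => prepend (seqInit n ω) (f (seqInit n ω) (seqDrop n ω))
      invFun := fun ω => prepend (seqInit n ω) ((f (seqInit n ω))⁻¹ (seqDrop n ω))
      left_inv := fun ω => by simp
      right_inv := fun ω => by simp }
  map_one' := by ext1 ω; exact prepend_init_drop n ω
  map_mul' f g := by ext1 ω; simp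

@[simp]
theorem blockHom_prepend {n : ℕ} (f : (Fin n → Bool) → Equiv.Perm (ℕ → Bool)) (v : Fin n → Bool)
    (ω : ℕ → Bool) : blockHom n f (prepend v ω) = prepend v (f v ω) := by
  simp [blockHom]

theorem blockHom_injective (n : ℕ) : Function.Injective (blockHom n) := by
  intro f g h
  ext1 v
  ext1 ω
  have := congrArg (fun p => p (prepend v ω)) h
  simp only [blockHom_prepend] at this
  exact (prepend_injective this).2

theorem blockHom_zero (f : (Fin 0 → Bool) → Equiv.Perm (ℕ → Bool)) (v : Fin 0 → Bool) :
    blockHom 0 f = f v := by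
  ext1 ω
  conv_lhs => rw [← prepend_zero v ω]
  rw [blockHom_prepend, prepend_zero]

theorem blockHom_succ {n : ℕ} (f : (Fin (n + 1) → Bool) → Equiv.Perm (ℕ → Bool)) :
    blockHom (n + 1) f = pairHom fun x => blockHom n fun v => f (Fin.cons x v) := by
  apply perm_ext_cons
  intro x ω
  obtain ⟨v, ω, rfl⟩ := exists_eq_prepend n ω
  rw [← prepend_cons, blockHom_prepend, prepend_cons, prepend_cons, pairHom_cons, blockHom_prepend]

theorem blockHom_add {n m : ℕ} (f : (Fin (n + m) → Bool) → Equiv.Perm (ℕ → Bool)) :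
    blockHom (n + m) f = blockHom n fun v => blockHom m fun u => f (Fin.append v u) := by
  apply perm_ext_prepend n
  intro v ω
  obtain ⟨u, ω, rfl⟩ := exists_eq_prepend m ω
  rw [← prepend_append, blockHom_prepend, prepend_append, prepend_append, blockHom_prepend,
    blockHom_prepend]

/-- The permutation acting as `g` on the sequences with initial segment `v`, trivially elsewhere. -/
noncomputable def blockAt {n : ℕ} (v : Fin n → Bool) :
    Equiv.Perm (ℕ → Bool) →* Equiv.Perm (ℕ → Bool) :=
  (blockHom n).comp (MonoidHom.mulSingle (fun _ => Equiv.Perm (ℕ → Bool)) v)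

theorem blockAt_eq {n : ℕ} (v : Fin n → Bool) (g : Equiv.Perm (ℕ → Bool)) :
    blockAt v g = blockHom n (Pi.mulSingle v g) := rfl

@[simp]
theorem blockAt_same {n : ℕ} (v : Fin n → Bool) (g : Equiv.Perm (ℕ → Bool)) (ω : ℕ → Bool) :
    blockAt v g (prepend v ω) = prepend v (g ω) := by
  simp [blockAt_eq]

theorem blockAt_of_ne {n : ℕ} {v u : Fin n → Bool} (h : u ≠ v) (g : Equiv.Perm (ℕ → Bool))
    (ω : ℕ → Bool) : blockAt v g (prepend u ω) = prepend u ω := by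
  simp [blockAt_eq, Pi.mulSingle_eq_of_ne h]

theorem blockAt_of_init_ne {n : ℕ} {v : Fin n → Bool} {ω : ℕ → Bool} (h : seqInit n ω ≠ v)
    (g : Equiv.Perm (ℕ → Bool)) : blockAt v g ω = ω := by
  conv_lhs => rw [← prepend_init_drop n ω]
  rw [blockAt_of_ne h, prepend_init_drop]

theorem blockAt_injective {n : ℕ} (v : Fin n → Bool) : Function.Injective (blockAt v) :=
  fun _ _ h => Pi.mulSingle_injective (M := fun _ => Equiv.Perm (ℕ → Bool)) v
    (blockHom_injective n h)

/-! ### Level subgroups -/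

/-- The group of block-diagonal permutations with all blocks, at level `n`, in `L`. -/
noncomputable def levelSubgroup (L : Subgroup (Equiv.Perm (ℕ → Bool))) (n : ℕ) :
    Subgroup (Equiv.Perm (ℕ → Bool)) :=
  (Subgroup.pi Set.univ fun _ => L).map (blockHom n)

theorem mem_levelSubgroup {L : Subgroup (Equiv.Perm (ℕ → Bool))} {n : ℕ}
    {g : Equiv.Perm (ℕ → Bool)} :
    g ∈ levelSubgroup L n ↔ ∃ f, (∀ v, f v ∈ L) ∧ blockHom n f = g := by
  simp [levelSubgroup, Subgroup.mem_map, Subgroup.mem_pi]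

theorem blockHom_mem_levelSubgroup {L : Subgroup (Equiv.Perm (ℕ → Bool))} {n : ℕ}
    {f : (Fin n → Bool) → Equiv.Perm (ℕ → Bool)} : blockHom n f ∈ levelSubgroup L n ↔ ∀ v, f v ∈ L := by
  rw [mem_levelSubgroup]
  refine ⟨?_, fun h => ⟨f, h, rfl⟩⟩
  rintro ⟨f', hf', h⟩
  rwa [← blockHom_injective n h]

theorem blockAt_mem_levelSubgroup {L : Subgroup (Equiv.Perm (ℕ → Bool))} {n : ℕ}
    {v : Fin n → Bool} {g : Equiv.Perm (ℕ → Bool)} (hg : g ∈ L) :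
    blockAt v g ∈ levelSubgroup L n := by
  rw [blockAt_eq, blockHom_mem_levelSubgroup]
  intro u
  by_cases h : u = v
  · subst h; simpa using hg
  · simp [Pi.mulSingle_eq_of_ne h, one_mem]

theorem levelSubgroup_zero (L : Subgroup (Equiv.Perm (ℕ → Bool))) : levelSubgroup L 0 = L := by
  ext g
  rw [mem_levelSubgroup]
  constructor
  · rintro ⟨f, hf, rfl⟩
    rw [blockHom_zero f default]
    exact hf _
  · intro h
    exact ⟨fun _ => g, fun _ => h, blockHom_zero _ default⟩

theorem mem_levelSubgroup_succ {L : Subgroup (Equiv.Perm (ℕ → Bool))} {n : ℕ}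
    {g : Equiv.Perm (ℕ → Bool)} :
    g ∈ levelSubgroup L (n + 1) ↔ ∃ f, (∀ x, f x ∈ levelSubgroup L n) ∧ pairHom f = g := by
  constructor
  · intro h
    obtain ⟨f, hf, rfl⟩ := mem_levelSubgroup.1 h
    exact ⟨_, fun x => blockHom_mem_levelSubgroup.2 fun v => hf _, (blockHom_succ f).symm⟩
  · rintro ⟨f, hf, rfl⟩
    simp only [mem_levelSubgroup] at hf
    choose F hF hF2 using hf
    refine mem_levelSubgroup.2 ⟨fun v => F (v 0) (Fin.tail v), fun v => hF _ _, ?_⟩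
    rw [blockHom_succ]
    congr 1
    funext x
    rw [← hF2 x]
    congr 1

theorem levelSubgroup_mono {L L' : Subgroup (Equiv.Perm (ℕ → Bool))} (h : L ≤ L') (n : ℕ) :
    levelSubgroup L n ≤ levelSubgroup L' n := by
  intro g hg
  obtain ⟨f, hf, rfl⟩ := mem_levelSubgroup.1 hg
  exact blockHom_mem_levelSubgroup.2 fun v => h (hf v)

theorem blockHom_mem_levelSubgroup_add {L : Subgroup (Equiv.Perm (ℕ → Bool))} {n m : ℕ}
    {f : (Fin n → Bool) → Equiv.Perm (ℕ → Bool)} :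
    blockHom n f ∈ levelSubgroup L (n + m) ↔ ∀ v, f v ∈ levelSubgroup L m := by
  constructor
  · intro h v
    obtain ⟨F, hF, h2⟩ := mem_levelSubgroup.1 h
    rw [blockHom_add] at h2
    rw [← blockHom_injective n h2]
    exact blockHom_mem_levelSubgroup.2 fun u => hF _
  · intro h
    simp only [mem_levelSubgroup] at h
    choose F hF hF2 using h
    refine mem_levelSubgroup.2
      ⟨fun w => F (fun i => w (Fin.castAdd m i)) (fun i => w (Fin.natAdd n i)), fun w => hF _ _, ?_⟩
    rw [blockHom_add]
    congr 1
    funext v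
    rw [← hF2 v]
    simp

theorem levelSubgroup_add (L : Subgroup (Equiv.Perm (ℕ → Bool))) (n m : ℕ) :
    levelSubgroup (levelSubgroup L m) n = levelSubgroup L (n + m) := by
  ext g
  constructor
  · intro h
    obtain ⟨f, hf, rfl⟩ := mem_levelSubgroup.1 h
    exact blockHom_mem_levelSubgroup_add.2 hf
  · intro h
    obtain ⟨F, hF, rfl⟩ := mem_levelSubgroup.1 h
    rw [blockHom_add]
    exact blockHom_mem_levelSubgroup.2 fun v => blockHom_mem_levelSubgroup.2 fun u => hF _

/-- A level subgroup is contained in `M` as soon as all its blocks are. -/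
theorem levelSubgroup_le {L M : Subgroup (Equiv.Perm (ℕ → Bool))} {n : ℕ}
    (h : ∀ (v : Fin n → Bool), ∀ g ∈ L, blockAt v g ∈ M) : levelSubgroup L n ≤ M := by
  refine Subgroup.map_le_iff_le_comap.2 fun f hf => ?_
  refine Subgroup.pi_mem_of_mulSingle_mem f fun v => ?_
  exact h v _ (hf v trivial)

theorem levelSubgroup_branchK_le (n : ℕ) : levelSubgroup branchK n ≤ branchK := by
  induction n with
  | zero => rw [levelSubgroup_zero]
  | succ n ih =>
    intro g hg
    obtain ⟨f, hf, rfl⟩ := mem_levelSubgroup_succ.1 hg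
    exact pairHom_mem_branchK fun x => ih (hf x)

theorem blockAt_mem_branchK {n : ℕ} (v : Fin n → Bool) {k : Equiv.Perm (ℕ → Bool)}
    (hk : k ∈ branchK) : blockAt v k ∈ branchK :=
  levelSubgroup_branchK_le n (blockAt_mem_levelSubgroup hk)

/-- Every generator other than `a` is block diagonal with respect to the first letter. -/
theorem grigPerm_eq_pairHom (s : GrigGen) : s = .a ∨ ∃ f : Bool → Equiv.Perm (ℕ → Bool),
    (∀ x, f x = 1 ∨ ∃ t, f x = grigPerm t) ∧ grigPerm s = pairHom f := by
  cases s with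
  | a => exact Or.inl rfl
  | b =>
    refine Or.inr ⟨fun x => bif x then gC else gA, ?_, gB_eq⟩
    rintro (_ | _)
    · exact Or.inr ⟨.a, rfl⟩
    · exact Or.inr ⟨.c, rfl⟩
  | c =>
    refine Or.inr ⟨fun x => bif x then gD else gA, ?_, gC_eq⟩
    rintro (_ | _)
    · exact Or.inr ⟨.a, rfl⟩
    · exact Or.inr ⟨.d, rfl⟩
  | d =>
    refine Or.inr ⟨fun x => bif x then gB else 1, ?_, gD_eq⟩
    rintro (_ | _)
    · exact Or.inl rfl
    · exact Or.inr ⟨.b, rfl⟩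

theorem gA_conj_pairHom (f : Bool → Equiv.Perm (ℕ → Bool)) :
    gA * pairHom f * gA = pairHom fun x => f (!x) := by
  rw [pairHom_eq_pair, pairHom_eq_pair, gA_conj_pair]
  rfl

/-- By induction on the level: a swaps the two halves, and the other generators act on each half as
a generator or trivially. -/
theorem grigPerm_conj_levelSubgroup {L : Subgroup (Equiv.Perm (ℕ → Bool))}
    (hL : ∀ g ∈ grigorchukGroup, ∀ x ∈ L, g * x * g⁻¹ ∈ L) (n : ℕ) (s : GrigGen) :
    ∀ x ∈ levelSubgroup L n, grigPerm s * x * grigPerm s ∈ levelSubgroup L n := by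
  induction n generalizing s with
  | zero =>
    intro x hx
    rw [levelSubgroup_zero] at hx ⊢
    have := hL _ (grigPerm_mem s) x hx
    rwa [grigPerm_inv] at this
  | succ n ih =>
    intro x hx
    obtain ⟨f, hf, rfl⟩ := mem_levelSubgroup_succ.1 hx
    rcases grigPerm_eq_pairHom s with rfl | ⟨F, hF, hs⟩
    · exact mem_levelSubgroup_succ.2 ⟨_, fun x => hf _, (gA_conj_pairHom f).symm⟩
    · refine mem_levelSubgroup_succ.2 ⟨F * f * F, fun x => ?_, by rw [map_mul, map_mul, hs]⟩
      simp only [Pi.mul_apply]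
      rcases hF x with h | ⟨t, h⟩
      · rw [h, one_mul, mul_one]; exact hf x
      · rw [h]; exact ih t _ (hf x)

theorem conj_mem_levelSubgroup {L : Subgroup (Equiv.Perm (ℕ → Bool))}
    (hL : ∀ g ∈ grigorchukGroup, ∀ x ∈ L, g * x * g⁻¹ ∈ L) (n : ℕ) :
    ∀ g ∈ grigorchukGroup, ∀ x ∈ levelSubgroup L n, g * x * g⁻¹ ∈ levelSubgroup L n :=
  fun _ hg => conj_mem_of_grigPerm (grigPerm_conj_levelSubgroup hL n) hg

theorem conj_mem_levelSubgroup_branchK (n : ℕ) :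
    ∀ g ∈ grigorchukGroup, ∀ x ∈ levelSubgroup branchK n, g * x * g⁻¹ ∈ levelSubgroup branchK n :=
  conj_mem_levelSubgroup (fun _ hg _ hk => conj_mem_branchK hg hk) n

/-! ### Sections and lifts -/

theorem exists_section_cons {g : Equiv.Perm (ℕ → Bool)} (hg : g ∈ grigorchukGroup) (x : Bool) :
    ∃ y, ∃ s ∈ grigorchukGroup, ∀ ω, g (seqCons x ω) = seqCons y (s ω) := by
  refine grig_induction (p := fun g => ∀ x, ∃ y, ∃ s ∈ grigorchukGroup, ∀ ω,
    g (seqCons x ω) = seqCons y (s ω)) (fun x => ⟨x, 1, one_mem _, fun _ => rfl⟩) ?_ hg x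
  intro t g _ ih x
  obtain ⟨y, s, hs, h⟩ := ih x
  rcases grigPerm_eq_pairHom t with rfl | ⟨F, hF, ht⟩
  · exact ⟨!y, s, hs, fun ω => by rw [Equiv.Perm.mul_apply, h]; exact gA_cons _ _⟩
  · refine ⟨y, F y * s, mul_mem ?_ hs, fun ω => ?_⟩
    · rcases hF y with h | ⟨u, h⟩
      · rw [h]; exact one_mem _
      · rw [h]; exact grigPerm_mem u
    · rw [Equiv.Perm.mul_apply, h, ht, pairHom_cons, Equiv.Perm.mul_apply]

/-- Sections of elements of the Grigorchuk group are in the Grigorchuk group. -/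
theorem exists_section {g : Equiv.Perm (ℕ → Bool)} (hg : g ∈ grigorchukGroup) {n : ℕ}
    (v : Fin n → Bool) :
    ∃ u : Fin n → Bool, ∃ s ∈ grigorchukGroup, ∀ ω, g (prepend v ω) = prepend u (s ω) := by
  induction n generalizing g with
  | zero => exact ⟨v, g, hg, fun ω => by simp [prepend_zero]⟩
  | succ n ih =>
    obtain ⟨y, s, hs, h⟩ := exists_section_cons hg (v 0)
    obtain ⟨u, r, hr, h2⟩ := ih hs (Fin.tail v)
    refine ⟨Fin.cons y u, r, hr, fun ω => ?_⟩
    conv_lhs => rw [← Fin.cons_self_tail v]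
    rw [prepend_cons, h, h2, prepend_cons]

/-- Below 1, the elements aba, d, b, c act as a, b, c, d and preserve the letter, so every element
is a section there; a moves between the two letters. -/
theorem exists_lift_cons {g : Equiv.Perm (ℕ → Bool)} (hg : g ∈ grigorchukGroup) (x y : Bool) :
    ∃ h ∈ grigorchukGroup, ∀ ω, h (seqCons x ω) = seqCons y (g ω) := by
  have key : ∃ h ∈ grigorchukGroup, ∀ ω, h (seqCons true ω) = seqCons true (g ω) := by
    refine grig_induction (p := fun g => ∃ h ∈ grigorchukGroup, ∀ ω,
      h (seqCons true ω) = seqCons true (g ω)) ⟨1, one_mem _, fun _ => rfl⟩ ?_ hg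
    rintro s g _ ⟨h, hh, h2⟩
    have : ∃ r ∈ grigorchukGroup, ∀ ω, r (seqCons true ω) = seqCons true (grigPerm s ω) := by
      cases s with
      | a =>
        refine ⟨gA * gB * gA, mul_mem (mul_mem (grigPerm_mem _) (grigPerm_mem _)) (grigPerm_mem _),
          fun ω => ?_⟩
        conv_lhs => rw [gB_eq, gA_conj_pair]
        exact pair_true _ _ _
      | b => exact ⟨gD, grigPerm_mem _, fun ω => (congrArg (fun p => p (seqCons true ω)) gD_eq)⟩
      | c => exact ⟨gB, grigPerm_mem _, fun ω => (congrArg (fun p => p (seqCons true ω)) gB_eq)⟩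
      | d => exact ⟨gC, grigPerm_mem _, fun ω => (congrArg (fun p => p (seqCons true ω)) gC_eq)⟩
    obtain ⟨r, hr, h3⟩ := this
    exact ⟨r * h, mul_mem hr hh, fun ω => by
      rw [Equiv.Perm.mul_apply, h2, h3, Equiv.Perm.mul_apply]⟩
  have swap : ∀ z w : Bool, ∃ r ∈ grigorchukGroup, ∀ ω, r (seqCons z ω) = seqCons w ω := by
    intro z w
    by_cases h : z = w
    · subst h; exact ⟨1, one_mem _, fun _ => rfl⟩
    · refine ⟨gA, grigPerm_mem _, fun ω => ?_⟩
      rw [gA_cons]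
      cases z <;> cases w <;> simp_all
  obtain ⟨h, hh, h1⟩ := key
  obtain ⟨r, hr, h2⟩ := swap x true
  obtain ⟨q, hq, h3⟩ := swap true y
  exact ⟨q * (h * r), mul_mem hq (mul_mem hh hr), fun ω => by
    rw [Equiv.Perm.mul_apply, Equiv.Perm.mul_apply, h2, h1, h3]⟩

/-- The Grigorchuk group is self-replicating and acts transitively on the levels of the tree. -/
theorem exists_lift {g : Equiv.Perm (ℕ → Bool)} (hg : g ∈ grigorchukGroup) {n : ℕ}
    (v u : Fin n → Bool) : ∃ h ∈ grigorchukGroup, ∀ ω, h (prepend v ω) = prepend u (g ω) := by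
  induction n with
  | zero => exact ⟨g, hg, fun ω => by simp [prepend_zero]⟩
  | succ n ih =>
    obtain ⟨h, hh, h1⟩ := ih (Fin.tail v) (Fin.tail u)
    obtain ⟨r, hr, h2⟩ := exists_lift_cons hh (v 0) (u 0)
    refine ⟨r, hr, fun ω => ?_⟩
    rw [← Fin.cons_self_tail v, ← Fin.cons_self_tail u, prepend_cons, prepend_cons, h2, h1]

/-- Conjugation moves blocks. -/
theorem conj_blockAt {n : ℕ} {v u : Fin n → Bool} {g s : Equiv.Perm (ℕ → Bool)}
    (h : ∀ ω, g (prepend v ω) = prepend u (s ω)) (k : Equiv.Perm (ℕ → Bool))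
    (hg : g ∈ grigorchukGroup) :
    g * blockAt v k * g⁻¹ = blockAt u (s * k * s⁻¹) := by
  rw [mul_inv_eq_iff_eq_mul]
  apply perm_ext_prepend n
  intro w ω
  by_cases hw : w = v
  · subst hw
    rw [Equiv.Perm.mul_apply, Equiv.Perm.mul_apply, blockAt_same, h, h, blockAt_same]
    congr 1
    simp [Equiv.Perm.mul_apply]
  · obtain ⟨z, r, hr, hz⟩ := exists_section hg w
    have hzu : z ≠ u := by
      rintro rfl
      have h1 := hz (r⁻¹ ω)
      have h2 := h (s⁻¹ ω)
      simp only [← Equiv.Perm.mul_apply, mul_inv_cancel, Equiv.Perm.one_apply] at h1 h2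
      exact hw (prepend_injective (g.injective (h1.trans h2.symm))).1
    rw [Equiv.Perm.mul_apply, Equiv.Perm.mul_apply, blockAt_of_ne hw, hz, blockAt_of_ne hzu]

/-- (ab)² acts below the first letter as ca or ac. As c preserves and a flips the leading letter,
the second letter of every sequence changes. -/
theorem gT_apply_ne (ω : ℕ → Bool) : gT ω ≠ ω := by
  obtain ⟨x, ω, rfl⟩ := exists_eq_seqCons ω
  obtain ⟨y, ω, rfl⟩ := exists_eq_seqCons ω
  have hc : ∀ z τ, ∃ τ', gC (seqCons z τ) = seqCons z τ' := by
    intro z τ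
    have := congrArg (fun p => p (seqCons z τ)) gC_eq
    exact ⟨_, this⟩
  rw [gT_eq]
  intro h
  cases x
  · rw [pair_false] at h
    have := (seqCons_injective h).2
    rw [Equiv.Perm.mul_apply, gA_cons] at this
    obtain ⟨τ, hτ⟩ := hc (!y) ω
    rw [hτ] at this
    simpa using (seqCons_injective this).1
  · rw [pair_true] at h
    have := (seqCons_injective h).2
    obtain ⟨τ, hτ⟩ := hc y ω
    rw [Equiv.Perm.mul_apply, hτ, gA_cons] at this
    simpa using (seqCons_injective this).1

/-! ### Generic tuples modulo a separating group of permutations -/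

section Separating

variable {X ι : Type*}

theorem perm_inv_apply_self (g : Equiv.Perm X) (p : X) : g⁻¹ (g p) = p := g.symm_apply_apply p

theorem perm_apply_inv_self (g : Equiv.Perm X) (p : X) : g (g⁻¹ p) = p := g.apply_symm_apply p

/-- `L` separates the points of the invariant set `O`: the pointwise stabiliser in `L` of a finite set
fixes no point of `O` outside that set. -/
def Separates (L : Subgroup (Equiv.Perm X)) (O : Set X) : Prop :=
  ∀ (Y : Finset X), ∀ p ∈ O, p ∉ Y → ∃ g ∈ L, (∀ y ∈ Y, g y = y) ∧ g p ≠ p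

/-- Otherwise the orbit of p under the stabiliser of Y lies in F, hence is finite. An element fixing
Y and the rest of that orbit, but moving p, would send p to a point it already fixes, against
injectivity. -/
theorem Separates.exists_apply_notMem {L : Subgroup (Equiv.Perm X)} {O : Set X}
    (hL : Separates L O) (Y F : Finset X) {p : X} (hp : p ∈ O) (hpY : p ∉ Y) :
    ∃ g ∈ L, (∀ y ∈ Y, g y = y) ∧ g p ∉ F := by
  classical
  by_contra! H
  set S : Finset X := F.filter fun q => (∃ g ∈ L, (∀ y ∈ Y, g y = y) ∧ g p = q) ∧ q ≠ p with hS
  obtain ⟨g, hg, hfix, hne⟩ := hL (Y ∪ S) p hp (by simp [hpY, hS])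
  have hgY : ∀ y ∈ Y, g y = y := fun y hy => hfix y (Finset.mem_union_left _ hy)
  have hgS : g p ∈ S := by
    rw [hS, Finset.mem_filter]
    exact ⟨H g hg hgY, ⟨g, hg, hgY, rfl⟩, hne⟩
  exact hne (g.injective (hfix _ (Finset.mem_union_right _ hgS)))

theorem lift_mk_cons_true {G : Type*} [Group G] (x : ι → G) (i : ι) (w : List (ι × Bool)) :
    FreeGroup.lift x (FreeGroup.mk ((i, true) :: w)) = x i * FreeGroup.lift x (FreeGroup.mk w) := by
  simp [FreeGroup.lift_mk]

theorem lift_mk_cons_false {G : Type*} [Group G] (x : ι → G) (i : ι) (w : List (ι × Bool)) :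
    FreeGroup.lift x (FreeGroup.mk ((i, false) :: w)) =
      (x i)⁻¹ * FreeGroup.lift x (FreeGroup.mk w) := by
  simp [FreeGroup.lift_mk]

/-- The trajectory of a point under a reduced word can be made to escape from a given finite set, by
modifying the letters by elements of a separating group without changing them on given finite
sets. -/
theorem exists_escaping_trajectory [Finite ι] {L : Subgroup (Equiv.Perm X)} {O : Set X}
    (hL : Separates L O) (hO : ∀ g ∈ L, ∀ p ∈ O, g p ∈ O) (F : Finset X)
    (w : List (ι × Bool)) (hw : FreeGroup.IsReduced w) (x₀ : ι → Equiv.Perm X)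
    (hx₀ : ∀ i p, x₀ i p ∈ O ↔ p ∈ O) (E₀ : ι → Finset X) (hE₀ : ∀ i, ∀ p ∈ E₀ i, p ∈ O)
    (p : X) (hp : p ∈ O) (hp1 : ∀ i, p ∉ E₀ i) (hp2 : ∀ i, (x₀ i)⁻¹ p ∉ E₀ i) :
    ∃ (x : ι → Equiv.Perm X) (E : ι → Finset X) (q : X),
      (∀ i, (x₀ i)⁻¹ * x i ∈ L) ∧ (∀ i, ∀ y ∈ E₀ i, x i y = x₀ i y) ∧ (∀ i, E₀ i ⊆ E i) ∧
      (∀ i, ∀ p ∈ E i, p ∈ O) ∧ q ∈ O ∧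
      (∀ x' : ι → Equiv.Perm X, (∀ i, ∀ y ∈ E i, x' i y = x i y) →
        FreeGroup.lift x' (FreeGroup.mk w) p = q) ∧
      (w ≠ [] → q ∉ F) ∧
      (∀ i, w.head? ≠ some (i, false) → q ∉ E i) ∧
      (∀ i, w.head? ≠ some (i, true) → (x i)⁻¹ q ∉ E i) := by
  classical
  have := Fintype.ofFinite ι
  -- The tail of the word acts first. `E i` collects the points where letter i is already committed.
  -- The last two conclusions say that the endpoint is fresh for every next letter except the
  -- inverse of the one just used, which is exactly what reducedness excludes.
  induction w with
  | nil =>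
    refine ⟨x₀, E₀, p, fun i => by simp [one_mem], fun _ _ _ => rfl, fun _ => subset_rfl, hE₀, hp, ?_,
      by simp, fun i _ => hp1 i, fun i _ => hp2 i⟩
    intro x' _
    rw [← FreeGroup.one_eq_mk, map_one, Equiv.Perm.one_apply]
  | cons s w ih =>
    have hw' : FreeGroup.IsReduced w := hw.infix ⟨[s], [], by simp⟩
    obtain ⟨x, E, q, h1, h2, h3, h4, h5, h6, -, h7, h8⟩ := ih hw'
    obtain ⟨i, b⟩ := s
    have hhead : w.head? ≠ some (i, !b) := by
      intro h
      cases w with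
      | nil => simp at h
      | cons t w =>
        simp only [List.head?_cons, Option.some.injEq] at h
        subst h
        have := (FreeGroup.isReduced_cons_cons.1 hw).1 rfl
        simp at this
    have hxO : ∀ j p, x j p ∈ O ↔ p ∈ O := by
      intro j p
      have e : x j p = x₀ j (((x₀ j)⁻¹ * x j) p) := by simp [Equiv.Perm.mul_apply]
      rw [e, hx₀]
      refine ⟨fun h => ?_, fun h => hO _ (h1 j) _ h⟩
      have := hO _ (inv_mem (h1 j)) _ h
      rwa [perm_inv_apply_self] at this
    -- The next point must avoid F, the current point, and all committed domains and images.
    set F' : Finset X := F ∪ {q} ∪ Finset.univ.biUnion E ∪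
      Finset.univ.biUnion fun j => (E j).image (x j) with hF'
    have hF1 : ∀ {r}, r ∉ F' → r ∉ F := fun h h' => h (by simp [hF', h'])
    have hF2 : ∀ {r}, r ∉ F' → r ≠ q := fun h h' => h (by simp [hF', h'])
    have hF3 : ∀ {r}, r ∉ F' → ∀ j, r ∉ E j := fun h j h' => h (by
      simp only [hF', Finset.mem_union, Finset.mem_biUnion, Finset.mem_univ, true_and]
      exact Or.inl (Or.inr ⟨j, h'⟩))
    have hF4 : ∀ {r}, r ∉ F' → ∀ j, (x j)⁻¹ r ∉ E j := fun h j h' => h (by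
      simp only [hF', Finset.mem_union, Finset.mem_biUnion, Finset.mem_univ, true_and,
        Finset.mem_image]
      exact Or.inr ⟨j, _, h', by simp⟩)
    cases b with
    | true =>
      have hqE : q ∉ E i := h7 i hhead
      -- Replacing letter i by `x i * g` keeps its committed values, since g fixes `E i`, and sends
      -- q to a point outside `F'`.
      obtain ⟨g, hg, hgE, hgF⟩ :=
        hL.exists_apply_notMem (E i) (F'.image ⇑(x i)⁻¹) h5 hqE
      have hnew : x i (g q) ∉ F' := fun h =>
        hgF (Finset.mem_image.2 ⟨_, h, by simp⟩)
      refine ⟨Function.update x i (x i * g), Function.update E i (insert q (E i)), x i (g q),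
        ?_, ?_, ?_, ?_, ?_, ?_, ?_, ?_, ?_⟩
      · intro j
        by_cases hj : j = i
        · subst hj; simpa [mul_assoc] using mul_mem (h1 j) hg
        · simpa [hj] using h1 j
      · intro j y hy
        by_cases hj : j = i
        · subst hj; simp [Equiv.Perm.mul_apply, hgE y (h3 j hy), h2 j y hy]
        · simpa [hj] using h2 j y hy
      · intro j
        by_cases hj : j = i
        · subst hj; simpa using (h3 j).trans (Finset.subset_insert _ _)
        · simpa [hj] using h3 j
      · intro j y hy
        by_cases hj : j = i
        · subst hj
          simp only [Function.update_self, Finset.mem_insert] at hy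
          rcases hy with rfl | hy
          · exact h5
          · exact h4 _ _ hy
        · exact h4 j y (by simpa [hj] using hy)
      · exact (hxO _ _).2 (hO g hg _ h5)
      · intro x' hx'
        rw [lift_mk_cons_true, Equiv.Perm.mul_apply, h6 x']
        · have := hx' i q (by simp)
          simpa [Equiv.Perm.mul_apply] using this
        · intro j y hy
          by_cases hj : j = i
          · subst hj
            have := hx' j y (by simp [hy])
            simpa [Equiv.Perm.mul_apply, hgE y hy] using this
          · have := hx' j y (by simpa [hj] using hy)
            simpa [hj] using this
      · exact fun _ => hF1 hnew
      · intro j _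
        by_cases hj : j = i
        · subst hj; simpa using ⟨hF2 hnew, hF3 hnew j⟩
        · simpa [hj] using hF3 hnew j
      · intro j hj
        have hj : j ≠ i := by rintro rfl; simp at hj
        simpa [hj] using hF4 hnew j
    | false =>
      have hrE : (x i)⁻¹ q ∉ E i := h8 i hhead
      have hrO : (x i)⁻¹ q ∈ O := by
        rw [← hxO i]; simpa using h5
      obtain ⟨g, hg, hgE, hnew⟩ := hL.exists_apply_notMem (E i) F' hrO hrE
      have hgE' : ∀ y ∈ E i, g⁻¹ y = y := fun y hy => by
        rw [Equiv.Perm.inv_eq_iff_eq, hgE y hy]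
      -- Here the inverse letter is applied, so it becomes `g * (x i)⁻¹`; the newly committed domain
      -- point is the new endpoint, whose image is q.
      refine ⟨Function.update x i (x i * g⁻¹), Function.update E i (insert (g ((x i)⁻¹ q)) (E i)),
        g ((x i)⁻¹ q), ?_, ?_, ?_, ?_, ?_, ?_, ?_, ?_, ?_⟩
      · intro j
        by_cases hj : j = i
        · subst hj; simpa [mul_assoc] using mul_mem (h1 j) (inv_mem hg)
        · simpa [hj] using h1 j
      · intro j y hy
        by_cases hj : j = i
        · subst hj
          rw [Function.update_self, Equiv.Perm.mul_apply, hgE' y (h3 j hy), h2 j y hy]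
        · simpa [hj] using h2 j y hy
      · intro j
        by_cases hj : j = i
        · subst hj; simpa using (h3 j).trans (Finset.subset_insert _ _)
        · simpa [hj] using h3 j
      · intro j y hy
        by_cases hj : j = i
        · subst hj
          simp only [Function.update_self, Finset.mem_insert] at hy
          rcases hy with rfl | hy
          · exact hO g hg _ hrO
          · exact h4 _ _ hy
        · exact h4 j y (by simpa [hj] using hy)
      · exact hO g hg _ hrO
      · intro x' hx'
        rw [lift_mk_cons_false, Equiv.Perm.mul_apply, h6 x', Equiv.Perm.inv_eq_iff_eq]
        · have := hx' i (g ((x i)⁻¹ q)) (by simp)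
          rw [this, Function.update_self, Equiv.Perm.mul_apply, perm_inv_apply_self,
            perm_apply_inv_self]
        · intro j y hy
          by_cases hj : j = i
          · subst hj
            have := hx' j y (by simp [hy])
            rwa [Function.update_self, Equiv.Perm.mul_apply, hgE' y hy] at this
          · have := hx' j y (by simpa [hj] using hy)
            simpa [hj] using this
      · exact fun _ => hF1 hnew
      · intro j hj
        have hj : j ≠ i := by rintro rfl; simp at hj
        simpa [hj] using hF3 hnew j
      · intro j _
        by_cases hj : j = i
        · subst hj
          rw [Function.update_self, Function.update_self, Finset.mem_insert, not_or]
          constructor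
          · intro h
            rw [Equiv.Perm.inv_eq_iff_eq, Equiv.Perm.mul_apply, perm_inv_apply_self,
              perm_apply_inv_self] at h
            exact hF2 hnew h
          · intro h
            rw [mul_inv_rev, inv_inv, Equiv.Perm.mul_apply] at h
            have h9 := hgE' _ h
            rw [perm_inv_apply_self] at h9
            rw [← h9] at h
            exact hF4 hnew j h
        · simpa [hj] using hF4 hnew j

/-- Finitely many reduced words can simultaneously be made non-trivial, in a way that depends only on
the values of the letters on finite sets. -/
theorem exists_generic_tuple [Finite ι] {L : Subgroup (Equiv.Perm X)} {O : Set X}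
    (hL : Separates L O) (hO : ∀ g ∈ L, ∀ p ∈ O, g p ∈ O) (hinf : O.Infinite)
    (W : List (List (ι × Bool))) (hW : ∀ w ∈ W, FreeGroup.IsReduced w ∧ w ≠ [])
    (x₀ : ι → Equiv.Perm X) (hx₀ : ∀ i p, x₀ i p ∈ O ↔ p ∈ O) :
    ∃ (x : ι → Equiv.Perm X) (E : ι → Finset X), (∀ i, (x₀ i)⁻¹ * x i ∈ L) ∧
      (∀ i, ∀ p ∈ E i, p ∈ O) ∧
      ∀ x' : ι → Equiv.Perm X, (∀ i, ∀ y ∈ E i, x' i y = x i y) →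
        ∀ w ∈ W, FreeGroup.lift x' (FreeGroup.mk w) ≠ 1 := by
  classical
  have := Fintype.ofFinite ι
  induction W with
  | nil => exact ⟨x₀, fun _ => ∅, fun i => by simp [one_mem], by simp, by simp⟩
  | cons w W ih =>
    obtain ⟨x, E, h1, h2, h3⟩ := ih fun w hw => hW w (List.mem_cons_of_mem _ hw)
    obtain ⟨hw1, hw2⟩ := hW w List.mem_cons_self
    have hxO : ∀ j p, x j p ∈ O ↔ p ∈ O := by
      intro j p
      have e : x j p = x₀ j (((x₀ j)⁻¹ * x j) p) := by simp [Equiv.Perm.mul_apply]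
      rw [e, hx₀]
      refine ⟨fun h => ?_, fun h => hO _ (h1 j) _ h⟩
      have := hO _ (inv_mem (h1 j)) _ h
      rwa [perm_inv_apply_self] at this
    -- A starting point fresh for all letters and inverses. Forbidding p as endpoint then makes the
    -- new word move p, while the values that handle the previous words are kept.
    obtain ⟨p, hp, hpn⟩ := hinf.exists_notMem_finset (Finset.univ.biUnion E ∪
      Finset.univ.biUnion fun j => (E j).image (x j))
    simp only [Finset.mem_union, Finset.mem_biUnion, Finset.mem_univ, true_and, Finset.mem_image,
      not_or, not_exists] at hpn
    obtain ⟨y, D, q, g1, g2, g3, g4, g5, g6, g7, -, -⟩ := exists_escaping_trajectory hL hO {p} w hw1 x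
      hxO E h2 p hp hpn.1 fun i hi => hpn.2 i _ ⟨hi, by simp⟩
    refine ⟨y, D, fun i => ?_, g4, ?_⟩
    · have := mul_mem (h1 i) (g1 i)
      rwa [mul_assoc, mul_inv_cancel_left] at this
    · intro x' hx' v hv
      rcases List.mem_cons.1 hv with rfl | hv
      · intro h
        have h8 := g6 x' hx'
        rw [h, Equiv.Perm.one_apply] at h8
        exact g7 hw2 (by simp [h8])
      · refine h3 x' (fun i z hz => ?_) v hv
        rw [hx' i z (g3 i hz), g2 i z hz]

end Separating

/-! ### Separation and non-commuting powers in the branching subgroup -/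

/-- The elements of `K` that are trivial near the points of `B`. -/
noncomputable def germStabilizer (B : Finset (ℕ → Bool)) : Subgroup (Equiv.Perm (ℕ → Bool)) where
  carrier := {g | g ∈ branchK ∧ ∃ m, ∀ f ∈ B, ∀ ω, seqInit m ω = seqInit m f → g ω = ω}
  one_mem' := ⟨one_mem _, 0, fun _ _ _ _ => rfl⟩
  mul_mem' := by
    rintro g h ⟨hg, m, hm⟩ ⟨hh, n, hn⟩
    have key : ∀ {i j : ℕ} (ω f : ℕ → Bool), i ≤ j → seqInit j ω = seqInit j f →
        seqInit i ω = seqInit i f := by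
      intro i j ω f hij h
      funext x
      exact congrFun h ⟨x, by omega⟩
    refine ⟨mul_mem hg hh, max m n, fun f hf ω hω => ?_⟩
    rw [Equiv.Perm.mul_apply, hn f hf ω (key _ _ (le_max_right _ _) hω),
      hm f hf ω (key _ _ (le_max_left _ _) hω)]
  inv_mem' := by
    rintro g ⟨hg, m, hm⟩
    refine ⟨inv_mem hg, m, fun f hf ω hω => ?_⟩
    rw [Equiv.Perm.inv_eq_iff_eq, hm f hf ω hω]

theorem exists_seqInit_ne (Y : Finset (ℕ → Bool)) {p : ℕ → Bool} (hp : p ∉ Y) :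
    ∃ m, ∀ n ≥ m, ∀ y ∈ Y, seqInit n y ≠ seqInit n p := by
  classical
  have h : ∀ y : ℕ → Bool, ∃ i, y ≠ p → y i ≠ p i := by
    intro y
    by_cases hy : y = p
    · exact ⟨0, fun h => (h hy).elim⟩
    · obtain ⟨i, hi⟩ := Function.ne_iff.1 hy
      exact ⟨i, fun _ => hi⟩
  choose i hi using h
  refine ⟨Y.sup i + 1, fun n hn y hy heq => ?_⟩
  have hyp : y ≠ p := fun h => hp (h ▸ hy)
  exact hi y hyp (congrFun heq ⟨i y, by have := Finset.le_sup (f := i) hy; omega⟩)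

/-- A copy of (ab)² at a prefix of p shared by no point of Y or B moves p and is trivial near B and
on Y. -/
theorem separates_germStabilizer (B : Finset (ℕ → Bool)) {O : Set (ℕ → Bool)}
    (hO : ∀ p ∈ O, p ∉ B) : Separates (germStabilizer B) O := by
  classical
  intro Y p hp hpY
  obtain ⟨m, hm⟩ := exists_seqInit_ne (Y ∪ B) (p := p) (by simp [hpY, hO p hp])
  refine ⟨blockAt (seqInit m p) gT, ⟨blockAt_mem_branchK _ gT_mem, m, fun f hf ω hω => ?_⟩,
    fun y hy => ?_, ?_⟩
  · exact blockAt_of_init_ne (by rw [hω]; exact hm m le_rfl f (by simp [hf])) _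
  · exact blockAt_of_init_ne (hm m le_rfl y (by simp [hy])) _
  · intro h
    rw [← prepend_init_drop m p, seqInit_prepend, blockAt_same] at h
    exact gT_apply_ne _ (prepend_injective h).2

/-- Powers of distinct generators of a free group do not commute. -/
theorem freeGroup_commutator_pow_ne_one {ι : Type*} {i j : ι} (hij : i ≠ j) {N : ℕ} (hN : 0 < N) :
    ⁅(FreeGroup.of i) ^ N, (FreeGroup.of j) ^ N⁆ ≠ 1 := by
  classical
  intro h
  rw [commutatorElement_eq_one_iff_mul_comm] at h
  -- Doubling and translation by 1 on ℚ: the two orders of composition send 0 to 2ᴺ·N and to N.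
  let x : ι → Equiv.Perm ℚ := fun l =>
    if l = i then Equiv.mulLeft₀ (2 : ℚ) two_ne_zero else Equiv.addRight 1
  have hx1 : ∀ (n : ℕ) (q : ℚ), ((x i) ^ n) q = 2 ^ n * q := by
    intro n
    induction n with
    | zero => simp
    | succ n ih => intro q; rw [pow_succ, Equiv.Perm.mul_apply, ih]; simp [x]; ring
  have hx2 : ∀ (n : ℕ) (q : ℚ), ((x j) ^ n) q = q + n := by
    intro n
    induction n with
    | zero => simp
    | succ n ih => intro q; rw [pow_succ, Equiv.Perm.mul_apply, ih]; simp [x, hij.symm]; ring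
  have h2 := congrArg (fun g => FreeGroup.lift x g 0) h
  simp only [map_mul, map_pow, FreeGroup.lift_apply_of, Equiv.Perm.mul_apply, hx1, hx2] at h2
  have h3 : (N : ℚ) ≠ 0 := by exact_mod_cast hN.ne'
  have h4 : (2 : ℚ) ^ N = 1 := by
    have : ((2 : ℚ) ^ N - 1) * N = 0 := by linarith
    rcases mul_eq_zero.1 this with h | h
    · linarith
    · exact (h3 h).elim
  have : (1 : ℚ) < 2 ^ N := one_lt_pow₀ (by norm_num) hN.ne'
  linarith

/-- The generic perturbation of the trivial pair, for a single word and without points to avoid. It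
is needed because sections can later be prescribed on block-diagonal elements only up to a fixed
power. -/
theorem exists_commutator_pow_ne_one {N : ℕ} (hN : 0 < N) :
    ∃ k ∈ branchK, ∃ l ∈ branchK, ⁅k ^ N, l ^ N⁆ ≠ 1 := by
  set w := ⁅(FreeGroup.of false) ^ N, (FreeGroup.of true) ^ N⁆ with hw
  have hw1 : w ≠ 1 := freeGroup_commutator_pow_ne_one (by simp) hN
  obtain ⟨x, E, h1, -, h2⟩ := exists_generic_tuple (ι := Bool)
    (separates_germStabilizer ∅ (O := Set.univ) (by simp)) (by simp) Set.infinite_univ [w.toWord]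
    (by
      simp only [List.mem_singleton, forall_eq]
      exact ⟨FreeGroup.isReduced_toWord, fun h => hw1 (FreeGroup.toWord_eq_nil_iff.1 h)⟩)
    (fun _ => 1) (by simp)
  refine ⟨x false, ?_, x true, ?_, ?_⟩
  · simpa using (h1 false).1
  · simpa using (h1 true).1
  · have := h2 x (fun _ _ _ => rfl) w.toWord (by simp)
    rw [FreeGroup.mk_toWord, hw, map_commutatorElement, map_pow, map_pow, FreeGroup.lift_apply_of,
      FreeGroup.lift_apply_of] at this
    exact this

/-! ### Normal subgroups -/

/-- A subgroup normalised by the Grigorchuk group contains `K` as soon as it contains `(ab)²`. -/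
theorem branchK_le_of_gT_mem {M : Subgroup (Equiv.Perm (ℕ → Bool))}
    (hM : ∀ g ∈ grigorchukGroup, ∀ x ∈ M, g * x * g⁻¹ ∈ M) (hT : gT ∈ M) : branchK ≤ M := by
  have h1 : pair 1 gT ∈ M := by
    have := hM gD (grigPerm_mem _) _ hT
    rw [gD_inv, gD_conj_gT] at this
    have := mul_mem hT (inv_mem this)
    rwa [mul_inv_rev, mul_inv_cancel_left, pair_inv, inv_one, inv_inv] at this
  have h2 : pair gT 1 ∈ M := by
    have := hM gA (grigPerm_mem _) _ h1
    rwa [gA_inv, gA_conj_pair] at this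
  refine (Subgroup.closure_le _).2 ?_
  rintro x (rfl | rfl | rfl)
  exacts [hT, h2, h1]

theorem blockAt_commute {n : ℕ} {v u : Fin n → Bool} (h : v ≠ u) (g k : Equiv.Perm (ℕ → Bool)) :
    Commute (blockAt v g) (blockAt u k) := by
  have := Pi.mulSingle_commute (f := fun _ : Fin n → Bool => Equiv.Perm (ℕ → Bool)) h g k
  exact this.map (blockHom n)

/-- The standard commutator computation in groups acting on trees. -/
theorem commutator_commutator_eq {G : Type*} [Group G] {s f g : G} (h1 : Commute (s * f * s⁻¹) f)
    (h2 : Commute (s * f * s⁻¹) g) : ⁅⁅s, f⁆, g⁆ = ⁅f⁻¹, g⁆ := by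
  have e : ⁅s, f⁆ = s * f * s⁻¹ * f⁻¹ := rfl
  rw [e]
  generalize s * f * s⁻¹ = A at h1 h2
  have h3 : Commute A (f⁻¹ * g * f) := (h1.inv_right.mul_right h2).mul_right h1
  calc ⁅A * f⁻¹, g⁆ = A * (f⁻¹ * g * f) * A⁻¹ * g⁻¹ := by
        simp only [commutatorElement_def, mul_inv_rev, inv_inv, mul_assoc]
    _ = ⁅f⁻¹, g⁆ := by
        rw [h3.eq, mul_inv_cancel_right]
        simp only [commutatorElement_def, inv_inv]

theorem blockAt_append {n m : ℕ} (v : Fin n → Bool) (u : Fin m → Bool)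
    (g : Equiv.Perm (ℕ → Bool)) : blockAt (Fin.append v u) g = blockAt v (blockAt u g) := by
  apply perm_ext_prepend (n + m)
  intro w ω
  obtain ⟨w1, w2, rfl⟩ : ∃ (w1 : Fin n → Bool) (w2 : Fin m → Bool), w = Fin.append w1 w2 :=
    ⟨_, _, (Fin.append_castAdd_natAdd).symm⟩
  by_cases h : Fin.append w1 w2 = Fin.append v u
  · rw [h, blockAt_same, prepend_append, prepend_append, blockAt_same, blockAt_same]
  · rw [blockAt_of_ne h, prepend_append]
    by_cases h1 : w1 = v
    · subst h1
      rw [blockAt_same, blockAt_of_ne (fun h2 => h (by rw [h2]))]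
    · rw [blockAt_of_ne h1]

/-- Repeated squaring: (ac)² has sections da and ad, and (ad)² has both sections b. -/
theorem gT_pow_four : gT ^ 4 = pair (pair (pair gB gB) (pair gB gB)) (pair (pair gB gB) (pair gB gB)) := by
  have e1 : (gA * gC) * (gA * gC) = pair (gD * gA) (gA * gD) := by
    calc (gA * gC) * (gA * gC) = gA * pair gA gD * gA * pair gA gD := by
          rw [← gC_eq]; simp only [mul_assoc]
      _ = _ := by rw [gA_conj_pair, pair_mul]
  have e2 : (gC * gA) * (gC * gA) = pair (gA * gD) (gD * gA) := by
    calc (gC * gA) * (gC * gA) = pair gA gD * (gA * pair gA gD * gA) := by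
          rw [← gC_eq]; simp only [mul_assoc]
      _ = _ := by rw [gA_conj_pair, pair_mul]
  have e3 : (gA * gD) * (gA * gD) = pair gB gB := by
    calc (gA * gD) * (gA * gD) = gA * pair 1 gB * gA * pair 1 gB := by
          rw [← gD_eq]; simp only [mul_assoc]
      _ = _ := by rw [gA_conj_pair, pair_mul, mul_one, one_mul]
  have e4 : (gD * gA) * (gD * gA) = pair gB gB := by
    calc (gD * gA) * (gD * gA) = pair 1 gB * (gA * pair 1 gB * gA) := by
          rw [← gD_eq]; simp only [mul_assoc]
      _ = _ := by rw [gA_conj_pair, pair_mul, mul_one, one_mul]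
  rw [show (4 : ℕ) = 2 * 2 from rfl, pow_mul, gT_eq, pow_two, pow_two, pair_mul, e1, e2, pair_mul,
    pair_mul, pair_mul, e3, e4]

/-- (ab)⁸ acts as b at 111, hence as c at 1111 and as d at 11111. Its commutator with (ab)² planted
at 11111 is therefore [d, (ab)²] planted there, that is, (ab)⁻² at 111111; this explains the 6. -/
theorem blockAt_gT_inv_mem_commutator :
    ∃ v : Fin 6 → Bool, blockAt v gT⁻¹ ∈ ⁅branchK, branchK⁆ := by
  have h5 : ∀ ω, (gT ^ 4) (prepend (fun _ : Fin 5 => true) ω) = prepend (fun _ : Fin 5 => true) (gD ω) := by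
    intro ω
    have hp : ∀ (n : ℕ) (τ : ℕ → Bool), prepend (fun _ : Fin (n + 1) => true) τ =
        seqCons true (prepend (fun _ : Fin n => true) τ) := by
      intro n τ
      rw [← prepend_cons]
      congr 1
      funext i
      refine Fin.cases rfl (fun _ => rfl) i
    have hb : ∀ τ, gB (seqCons true τ) = seqCons true (gC τ) := fun τ => (grigAct_b_cons τ).2
    have hc : ∀ τ, gC (seqCons true τ) = seqCons true (gD τ) := fun τ => (grigAct_c_cons τ).2
    simp only [hp, prepend_zero, gT_pow_four, pair_true, hb, hc]
  have h6 : ⁅gT ^ 4, blockAt (fun _ : Fin 5 => true) gT⁆ =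
      blockAt (fun _ : Fin 5 => true) (pair 1 gT⁻¹) := by
    rw [commutatorElement_def, conj_blockAt h5 gT (pow_mem gT_mem_grig 4), ← map_inv, ← map_mul,
      gD_inv, gD_conj_gT, mul_inv_cancel_right]
  have h7 : pair 1 gT⁻¹ = blockAt (fun _ : Fin 1 => true) gT⁻¹ := by
    apply perm_ext_prepend 1
    intro w ω
    have hw : ∀ (w : Fin 1 → Bool) τ, prepend w τ = seqCons (w 0) τ := fun w τ => by
      rw [← Fin.cons_self_tail w, prepend_cons, prepend_zero]; rfl
    cases h : w 0 with
    | false =>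
      rw [blockAt_of_ne (fun h2 => by rw [h2] at h; simp at h), hw, h]; rfl
    | true =>
      obtain rfl : w = fun _ => true := by
        funext i; rw [Subsingleton.elim i 0, h]
      rw [blockAt_same, hw, hw, pair_true]
  refine ⟨Fin.append (fun _ : Fin 5 => true) (fun _ : Fin 1 => true), ?_⟩
  rw [blockAt_append, ← h7, ← h6]
  exact Subgroup.commutator_mem_commutator (pow_mem gT_mem 4) (blockAt_mem_branchK _ gT_mem)

theorem conj_mem_commutator_branchK :
    ∀ g ∈ grigorchukGroup, ∀ x ∈ ⁅branchK, branchK⁆, g * x * g⁻¹ ∈ ⁅branchK, branchK⁆ := by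
  intro g hg x hx
  have h : ⁅branchK, branchK⁆ ≤ (⁅branchK, branchK⁆).comap (MulAut.conj g).toMonoidHom := by
    rw [Subgroup.commutator_le]
    intro k hk l hl
    rw [Subgroup.mem_comap, map_commutatorElement]
    exact Subgroup.commutator_mem_commutator (conj_mem_branchK hg hk) (conj_mem_branchK hg hl)
  exact h hx

/-- A subgroup normalised by the Grigorchuk group contains a block as soon as it contains one at the
same level. -/
theorem blockAt_mem_of_blockAt_mem {M : Subgroup (Equiv.Perm (ℕ → Bool))}
    (hM : ∀ g ∈ grigorchukGroup, ∀ x ∈ M, g * x * g⁻¹ ∈ M) {n : ℕ} {v : Fin n → Bool}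
    {k : Equiv.Perm (ℕ → Bool)} (h : blockAt v k ∈ M) {g : Equiv.Perm (ℕ → Bool)}
    (hg : g ∈ grigorchukGroup) (u : Fin n → Bool) : blockAt u (g * k * g⁻¹) ∈ M := by
  obtain ⟨r, hr, h2⟩ := exists_lift hg v u
  rw [← conj_blockAt h2 k hr]
  exact hM r hr _ h

/-- Conjugation carries the block just found to every vertex of level 6, and the elements planted
there form a normalised subgroup containing (ab)², hence K. -/
theorem levelSubgroup_le_commutator_branchK : levelSubgroup branchK 6 ≤ ⁅branchK, branchK⁆ := by
  obtain ⟨v, hv⟩ := blockAt_gT_inv_mem_commutator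
  refine levelSubgroup_le fun u => ?_
  refine branchK_le_of_gT_mem (M := (⁅branchK, branchK⁆).comap (blockAt u)) ?_ ?_
  · intro g hg x hx
    exact blockAt_mem_of_blockAt_mem conj_mem_commutator_branchK hx hg u
  · have := blockAt_mem_of_blockAt_mem conj_mem_commutator_branchK hv (one_mem _) u
    rw [one_mul, inv_one, mul_one, map_inv] at this
    exact (inv_mem_iff (x := blockAt u gT)).1 this

/-- An element of the Grigorchuk group moving a vertex. -/
theorem exists_moved_vertex {s : Equiv.Perm (ℕ → Bool)} (hs : s ∈ grigorchukGroup) (h1 : s ≠ 1) :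
    ∃ (n : ℕ) (v u : Fin n → Bool), u ≠ v ∧ ∃ r ∈ grigorchukGroup,
      ∀ ω, s (prepend v ω) = prepend u (r ω) := by
  obtain ⟨ω, hω⟩ : ∃ ω, s ω ≠ ω := by
    by_contra! h
    exact h1 (Equiv.ext h)
  obtain ⟨i, hi⟩ := Function.ne_iff.1 hω
  obtain ⟨u, r, hr, h⟩ := exists_section hs (seqInit (i + 1) ω)
  refine ⟨i + 1, seqInit (i + 1) ω, u, ?_, r, hr, h⟩
  rintro rfl
  have h2 := congrFun (congrArg (seqInit (i + 1)) (h (seqDrop (i + 1) ω))) ⟨i, Nat.lt_succ_self i⟩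
  rw [prepend_init_drop, seqInit_prepend] at h2
  exact hi h2

/-- Non-trivial normal subgroups of the Grigorchuk group contain a level subgroup. -/
theorem exists_levelSubgroup_le {N : Subgroup (Equiv.Perm (ℕ → Bool))}
    (hN : ∀ g ∈ grigorchukGroup, ∀ x ∈ N, g * x * g⁻¹ ∈ N) {s : Equiv.Perm (ℕ → Bool)}
    (hs : s ∈ grigorchukGroup) (hsN : s ∈ N) (h1 : s ≠ 1) : ∃ m, levelSubgroup branchK m ≤ N := by
  obtain ⟨n, v, u, huv, r, hr, h⟩ := exists_moved_vertex hs h1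
  have hcomm : ∀ x ∈ N, ∀ g ∈ grigorchukGroup, ⁅x, g⁆ ∈ N := by
    intro x hx g hg
    have := mul_mem hx (hN g hg _ (inv_mem hx))
    rwa [← mul_assoc, ← mul_assoc] at this
  have hK : ∀ {k}, k ∈ branchK → blockAt v k ∈ grigorchukGroup :=
    fun hk => branchK_le (blockAt_mem_branchK v hk)
  have key : ⁅branchK, branchK⁆ ≤ N.comap (blockAt v) := by
    rw [Subgroup.commutator_le]
    intro k hk l hl
    -- Since s moves v, the conjugate by s of a block at v commutes with all blocks at v. The double
    -- commutator thus loses s and becomes the block of [k, l].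
    have h2 := hcomm _ (hcomm _ hsN _ (hK (inv_mem hk))) _ (hK hl)
    rw [commutator_commutator_eq] at h2
    · rw [map_inv, inv_inv, ← map_commutatorElement] at h2
      exact h2
    · rw [conj_blockAt h _ hs]; exact blockAt_commute huv _ _
    · rw [conj_blockAt h _ hs]; exact blockAt_commute huv _ _
  refine ⟨n + 6, ?_⟩
  rw [← levelSubgroup_add]
  refine levelSubgroup_le fun w k hk => ?_
  have := blockAt_mem_of_blockAt_mem hN (key (levelSubgroup_le_commutator_branchK hk)) (one_mem _) w
  simpa using this

/-! ### Finite quotients of the Grigorchuk group -/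

/-- In a finite `p`-group, a subgroup that generates modulo the commutators is everything. -/
theorem eq_top_of_sup_commutator_eq_top {Q : Type*} [Group Q] [Finite Q] [Group.IsNilpotent Q]
    {H : Subgroup Q} (h : H ⊔ commutator Q = ⊤) : H = ⊤ := by
  rcases eq_top_or_exists_le_coatom H with h1 | ⟨M, hM, hHM⟩
  · exact h1
  have hnorm : M.Normal := Subgroup.NormalizerCondition.normal_of_coatom M
    Group.normalizerCondition_of_isNilpotent hM
  obtain ⟨g, hg⟩ : ∃ g, g ∉ M := by
    by_contra! h2
    exact hM.1 ((Subgroup.eq_top_iff' M).2 h2)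
  -- A maximal subgroup of a nilpotent group is normal, and any element outside it generates the
  -- quotient; so the quotient is abelian and M contains the commutators.
  have h3 : M ⊔ Subgroup.zpowers g = ⊤ := by
    refine hM.2 _ (lt_of_le_of_ne le_sup_left fun h4 => hg ?_)
    rw [h4]
    exact (le_sup_right : Subgroup.zpowers g ≤ _) (Subgroup.mem_zpowers g)
  have hcyc : IsCyclic (Q ⧸ M) := by
    rw [isCyclic_iff_exists_zpowers_eq_top]
    refine ⟨(g : Q ⧸ M), ?_⟩
    have h5 := congrArg (Subgroup.map (QuotientGroup.mk' M)) h3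
    rw [Subgroup.map_sup, QuotientGroup.map_mk'_self, bot_sup_eq, MonoidHom.map_zpowers,
      Subgroup.map_top_of_surjective _ (QuotientGroup.mk'_surjective M)] at h5
    exact h5
  have hcomm : commutator Q ≤ M := by
    rw [← Subgroup.Normal.quotient_commutative_iff_commutator_le]
    exact ⟨⟨fun a b => (IsCyclic.commGroup (α := Q ⧸ M)).mul_comm a b⟩⟩
  exact (hM.1 (top_le_iff.1 (h ▸ sup_le hHM hcomm))).elim

/-- A group generated by three involutions `α`, `β`, `δ` with `β` central. -/
theorem exists_normal_form {Q : Type*} [Group Q] {α β δ : Q} (hα : α * α = 1) (hβ : β * β = 1)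
    (hδ : δ * δ = 1) (h1 : Commute β α) (h2 : Commute β δ)
    (hgen : Subgroup.closure {α, β, δ} = ⊤) (q : Q) :
    ∃ i : ℤ, ∃ j k : ℕ, q = (α * δ) ^ i * α ^ j * β ^ k := by
  have hα' : α⁻¹ = α := inv_eq_of_mul_eq_one_left hα
  have hβ' : β⁻¹ = β := inv_eq_of_mul_eq_one_left hβ
  have hδ' : δ⁻¹ = δ := inv_eq_of_mul_eq_one_left hδ
  have hconj : ∀ i : ℤ, α * (α * δ) ^ i = (α * δ) ^ (-i) * α := by
    intro i
    have : α * (α * δ) * α⁻¹ = (α * δ)⁻¹ := by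
      rw [mul_inv_rev, hδ', hα', ← mul_assoc, hα, one_mul]
    rw [zpow_neg, ← inv_zpow, ← this, conj_zpow, inv_mul_cancel_right]
  have mα : ∀ q, (∃ i : ℤ, ∃ j k : ℕ, q = (α * δ) ^ i * α ^ j * β ^ k) →
      ∃ i : ℤ, ∃ j k : ℕ, α * q = (α * δ) ^ i * α ^ j * β ^ k := by
    rintro _ ⟨i, j, k, rfl⟩
    refine ⟨-i, j + 1, k, ?_⟩
    rw [← mul_assoc, ← mul_assoc, hconj, pow_succ', ← mul_assoc]
  have mβ : ∀ q, (∃ i : ℤ, ∃ j k : ℕ, q = (α * δ) ^ i * α ^ j * β ^ k) →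
      ∃ i : ℤ, ∃ j k : ℕ, β * q = (α * δ) ^ i * α ^ j * β ^ k := by
    rintro _ ⟨i, j, k, rfl⟩
    refine ⟨i, j, k + 1, ?_⟩
    have : Commute β ((α * δ) ^ i * α ^ j) := ((h1.mul_right h2).zpow_right i).mul_right
      (h1.pow_right j)
    rw [← mul_assoc, this.eq, pow_succ', mul_assoc]
  have mδ : ∀ q, (∃ i : ℤ, ∃ j k : ℕ, q = (α * δ) ^ i * α ^ j * β ^ k) →
      ∃ i : ℤ, ∃ j k : ℕ, δ * q = (α * δ) ^ i * α ^ j * β ^ k := by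
    intro q hq
    have e : δ * q = α * (α * δ * q) := by rw [← mul_assoc, ← mul_assoc, hα, one_mul]
    rw [e]
    refine mα _ ?_
    obtain ⟨i, j, k, rfl⟩ := hq
    refine ⟨i + 1, j, k, ?_⟩
    rw [add_comm, zpow_add, zpow_one]
    simp only [mul_assoc]
  have hq : q ∈ Subgroup.closure {α, β, δ} := by rw [hgen]; trivial
  induction hq using Subgroup.closure_induction_left with
  | one => exact ⟨0, 0, 0, by simp⟩
  | mul_left x hx y _ h =>
    rcases hx with rfl | rfl | rfl
    exacts [mα _ h, mβ _ h, mδ _ h]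
  | inv_mul_cancel x hx y _ h =>
    rcases hx with rfl | rfl | rfl
    · rw [hα']; exact mα _ h
    · rw [hβ']; exact mβ _ h
    · rw [hδ']; exact mδ _ h

/-- By the normal form, Q is a quotient of the product of the dihedral group of order 8 and a group
of order 2: rotations have trivial fourth power, reflections trivial square, and β is central. -/
theorem pow_four_and_finite_of_relations {Q : Type*} [Group Q] {α β δ : Q} (hα : α * α = 1)
    (hβ : β * β = 1) (hδ : δ * δ = 1) (h1 : Commute β α) (h2 : Commute β δ)
    (h3 : (α * δ) ^ 4 = 1) (hgen : Subgroup.closure {α, β, δ} = ⊤) :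
    (∀ q : Q, q ^ 4 = 1) ∧ Finite Q := by
  have hα' : α⁻¹ = α := inv_eq_of_mul_eq_one_left hα
  have hδ' : δ⁻¹ = δ := inv_eq_of_mul_eq_one_left hδ
  have red : ∀ (γ : Q), γ * γ = 1 → ∀ j : ℕ, γ ^ j = 1 ∨ γ ^ j = γ := by
    intro γ hγ j
    induction j with
    | zero => simp
    | succ j ih =>
      rcases ih with h | h
      · right; rw [pow_succ, h, one_mul]
      · left; rw [pow_succ, h, hγ]
  have red4 : ∀ i : ℤ, ∃ l : Fin 4, (α * δ) ^ i = (α * δ) ^ (l : ℕ) := by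
    intro i
    refine ⟨⟨(i % 4).toNat, by omega⟩, ?_⟩
    have e : i = 4 * (i / 4) + ((i % 4).toNat : ℤ) := by omega
    have h4 : (α * δ) ^ (4 : ℤ) = 1 := by exact_mod_cast h3
    conv_lhs => rw [e, zpow_add, zpow_mul, h4, one_zpow, one_mul]
    exact zpow_natCast _ _
  have nf := exists_normal_form hα hβ hδ h1 h2 hgen
  constructor
  · intro q
    obtain ⟨i, j, k, rfl⟩ := nf q
    have hc : Commute ((α * δ) ^ i * α ^ j) (β ^ k) :=
      ((((h1.mul_right h2).zpow_right i).mul_right (h1.pow_right j)).pow_left k).symm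
    have hβ4 : (β ^ k) ^ 4 = 1 := by
      rw [← pow_mul, mul_comm, pow_mul, show (4 : ℕ) = 2 * 2 from rfl, pow_mul, pow_two β, hβ, one_pow, one_pow]
    rw [hc.mul_pow, hβ4, mul_one]
    rcases red α hα j with h | h
    · rw [h, mul_one, ← zpow_natCast, ← zpow_mul, mul_comm, zpow_mul, zpow_natCast, h3, one_zpow]
    · have : (α * δ) ^ i * α * ((α * δ) ^ i * α) = 1 := by
        have e : α * (α * δ) * α⁻¹ = (α * δ)⁻¹ := by
          rw [mul_inv_rev, hδ', hα', ← mul_assoc, hα, one_mul]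
        have e2 : α * (α * δ) ^ i * α⁻¹ = ((α * δ) ^ i)⁻¹ := by
          rw [← conj_zpow, e, inv_zpow]
        calc (α * δ) ^ i * α * ((α * δ) ^ i * α) = (α * δ) ^ i * (α * (α * δ) ^ i * α⁻¹) := by
              rw [hα']; simp only [mul_assoc]
          _ = 1 := by rw [e2, mul_inv_cancel]
      rw [h, show (4 : ℕ) = 2 * 2 from rfl, pow_mul, pow_two (_ * α), this, one_pow]
  · refine Finite.of_surjective (fun t : Fin 4 × Fin 2 × Fin 2 =>
      (α * δ) ^ (t.1 : ℕ) * α ^ (t.2.1 : ℕ) * β ^ (t.2.2 : ℕ)) fun q => ?_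
    obtain ⟨i, j, k, rfl⟩ := nf q
    obtain ⟨l, hl⟩ := red4 i
    have red2 : ∀ (γ : Q), γ * γ = 1 → ∀ j : ℕ, ∃ m : Fin 2, γ ^ (m : ℕ) = γ ^ j := by
      intro γ hγ j
      rcases red γ hγ j with h | h
      · exact ⟨0, by simp [h]⟩
      · exact ⟨1, by simp [h]⟩
    obtain ⟨m, hm⟩ := red2 α hα j
    obtain ⟨n, hn⟩ := red2 β hβ k
    exact ⟨(l, m, n), by simp only [hl, hm, hn]⟩

/-- The level subgroup of `K` inside the Grigorchuk group. -/
noncomputable abbrev levelInGrig (n : ℕ) : Subgroup grigorchukGroup :=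
  (levelSubgroup branchK n).subgroupOf grigorchukGroup

instance levelInGrig_normal (n : ℕ) : (levelInGrig n).Normal :=
  ⟨fun x hx g => conj_mem_levelSubgroup_branchK n g g.2 x hx⟩

/-- The generators as elements of the Grigorchuk group. -/
noncomputable def grigElem (s : GrigGen) : grigorchukGroup := ⟨grigPerm s, grigPerm_mem s⟩

theorem grigElem_induction {p : grigorchukGroup → Prop} (one : p 1)
    (mul : ∀ s g, p g → p (grigElem s * g)) (g : grigorchukGroup) : p g :=
  grig_induction (p := fun g => ∀ hg, p ⟨g, hg⟩) (fun _ => one)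
    (fun s g hg h _ => mul s ⟨g, hg⟩ (h hg)) g.2 g.2

theorem closure_grigElem : Subgroup.closure {grigElem .a, grigElem .b, grigElem .d} = ⊤ := by
  rw [Subgroup.eq_top_iff']
  refine grigElem_induction (one_mem _) fun s g hg => mul_mem ?_ hg
  have ha : grigElem .a ∈ Subgroup.closure {grigElem .a, grigElem .b, grigElem .d} :=
    Subgroup.subset_closure (by simp)
  have hb : grigElem .b ∈ Subgroup.closure {grigElem .a, grigElem .b, grigElem .d} :=
    Subgroup.subset_closure (by simp)
  have hd : grigElem .d ∈ Subgroup.closure {grigElem .a, grigElem .b, grigElem .d} :=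
    Subgroup.subset_closure (by simp)
  cases s with
  | a => exact ha
  | b => exact hb
  | d => exact hd
  | c =>
    have : grigElem .c = grigElem .b * grigElem .d := Subtype.ext gB_mul_gD.symm
    rw [this]
    exact mul_mem hb hd

/-- Modulo K the generators a and b commute, because [a, b] = (ab)²; b and d commute anyway, and
(ad)⁴ = 1 because (ad)² = (b, b). -/
theorem grigQuotient_branchK :
    (∀ q : grigorchukGroup ⧸ levelInGrig 0, q ^ 4 = 1) ∧ Finite (grigorchukGroup ⧸ levelInGrig 0) := by
  have hrel : ∀ g h : grigorchukGroup, (g : Equiv.Perm (ℕ → Bool))⁻¹ * h ∈ branchK →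
      (g : grigorchukGroup ⧸ levelInGrig 0) = h := by
    intro g h hgh
    rw [QuotientGroup.eq, Subgroup.mem_subgroupOf, levelSubgroup_zero]
    exact hgh
  refine pow_four_and_finite_of_relations (α := ((grigElem .a : grigorchukGroup) : _ ⧸ levelInGrig 0))
    (β := (grigElem .b : grigorchukGroup)) (δ := (grigElem .d : grigorchukGroup))
    ?_ ?_ ?_ ?_ ?_ ?_ ?_
  · rw [← QuotientGroup.mk_mul, show grigElem .a * grigElem .a = 1 from Subtype.ext gA_mul_self]; rfl
  · rw [← QuotientGroup.mk_mul, show grigElem .b * grigElem .b = 1 from Subtype.ext gB_mul_self]; rfl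
  · rw [← QuotientGroup.mk_mul, show grigElem .d * grigElem .d = 1 from Subtype.ext gD_mul_self]; rfl
  · refine (hrel (grigElem .b * grigElem .a) (grigElem .a * grigElem .b) ?_)
    have : (gB * gA)⁻¹ * (gA * gB) = gT := by
      simp only [mul_inv_rev, gA_inv, gB_inv, gT, mul_assoc]
    exact this ▸ gT_mem
  · have : grigElem .b * grigElem .d = grigElem .d * grigElem .b :=
      Subtype.ext (gB_mul_gD.trans gD_mul_gB.symm)
    show ((grigElem .b * grigElem .d : grigorchukGroup) : _ ⧸ levelInGrig 0) =
      ((grigElem .d * grigElem .b : grigorchukGroup) : _ ⧸ levelInGrig 0)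
    rw [this]
  · have e3 : (gA * gD) * (gA * gD) = pair gB gB := by
      calc (gA * gD) * (gA * gD) = gA * pair 1 gB * gA * pair 1 gB := by
            rw [← gD_eq]; simp only [mul_assoc]
        _ = _ := by rw [gA_conj_pair, pair_mul, mul_one, one_mul]
    have e4 : (grigElem .a * grigElem .d) ^ 4 = 1 := by
      apply Subtype.ext
      show (gA * gD) ^ 4 = 1
      rw [show (4 : ℕ) = 2 * 2 from rfl, pow_mul, pow_two, pow_two, e3, pair_mul, gB_mul_self,
        pair_one]
    show (((grigElem .a * grigElem .d) ^ 4 : grigorchukGroup) : _ ⧸ levelInGrig 0) = 1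
    rw [e4]; rfl
  · have h := congrArg (Subgroup.map (QuotientGroup.mk' (levelInGrig 0))) closure_grigElem
    rw [MonoidHom.map_closure, Subgroup.map_top_of_surjective _ (QuotientGroup.mk'_surjective _),
      Set.image_insert_eq, Set.image_insert_eq, Set.image_singleton] at h
    exact h

theorem pow_four_mem_branchK {g : Equiv.Perm (ℕ → Bool)} (hg : g ∈ grigorchukGroup) :
    g ^ 4 ∈ branchK := by
  have h := grigQuotient_branchK.1 ((⟨g, hg⟩ : grigorchukGroup) : _ ⧸ levelInGrig 0)
  have h2 : (((⟨g, hg⟩ : grigorchukGroup) ^ 4 : grigorchukGroup) : _ ⧸ levelInGrig 0) = 1 := h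
  rw [QuotientGroup.eq_one_iff, Subgroup.mem_subgroupOf, levelSubgroup_zero] at h2
  exact h2

theorem branchK_le_levelSubgroup_grig : branchK ≤ levelSubgroup grigorchukGroup 1 := by
  have h : ∀ {g k}, g ∈ grigorchukGroup → k ∈ grigorchukGroup →
      pair g k ∈ levelSubgroup grigorchukGroup 1 := by
    intro g k hg hk
    refine mem_levelSubgroup_succ.2 ⟨fun x => bif x then k else g, ?_, rfl⟩
    rw [levelSubgroup_zero]
    rintro (_ | _)
    exacts [hg, hk]
  refine (Subgroup.closure_le _).2 ?_
  rintro x (rfl | rfl | rfl)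
  · rw [gT_eq]
    exact h (mul_mem (grigPerm_mem _) (grigPerm_mem _)) (mul_mem (grigPerm_mem _) (grigPerm_mem _))
  · exact h gT_mem_grig (one_mem _)
  · exact h (one_mem _) gT_mem_grig

theorem levelSubgroup_branchK_le_grig (n : ℕ) :
    levelSubgroup branchK n ≤ levelSubgroup grigorchukGroup (n + 1) := by
  rw [← levelSubgroup_add]
  exact levelSubgroup_mono branchK_le_levelSubgroup_grig n

theorem pow_four_mem_levelSubgroup {n : ℕ} {g : Equiv.Perm (ℕ → Bool)}
    (hg : g ∈ levelSubgroup grigorchukGroup n) : g ^ 4 ∈ levelSubgroup branchK n := by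
  obtain ⟨f, hf, rfl⟩ := mem_levelSubgroup.1 hg
  rw [← map_pow]
  exact blockHom_mem_levelSubgroup.2 fun v => pow_four_mem_branchK (hf v)

/-- A fourth power lies in K, whose elements split into two blocks from the group; each further
fourth power descends one level. This makes the quotients 2-groups and turns high powers into
block-diagonal elements. -/
theorem pow_mem_levelSubgroup {g : Equiv.Perm (ℕ → Bool)} (hg : g ∈ grigorchukGroup) (n : ℕ) :
    g ^ (4 ^ (n + 1)) ∈ levelSubgroup branchK n := by
  induction n with
  | zero => rw [levelSubgroup_zero, zero_add, pow_one]; exact pow_four_mem_branchK hg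
  | succ n ih =>
    rw [pow_succ, pow_mul]
    exact pow_four_mem_levelSubgroup (levelSubgroup_branchK_le_grig n ih)

theorem relIndex_levelSubgroup_ne_zero {L M : Subgroup (Equiv.Perm (ℕ → Bool))}
    (h : L.relIndex M ≠ 0) (n : ℕ) : (levelSubgroup L n).relIndex (levelSubgroup M n) ≠ 0 := by
  rw [levelSubgroup, levelSubgroup, Subgroup.relIndex_map_map_of_injective _ _ (blockHom_injective n)]
  have e : Subgroup.pi Set.univ (fun _ : Fin n → Bool => L) =
      ⨅ v : Fin n → Bool, L.comap (Pi.evalMonoidHom _ v) := by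
    ext f
    simp [Subgroup.mem_pi, Subgroup.mem_iInf]
  rw [e]
  refine Subgroup.relIndex_iInf_ne_zero fun v => ?_
  rw [Subgroup.relIndex_comap]
  refine fun h0 => h (Subgroup.relIndex_eq_zero_of_le_right ?_ h0)
  rintro _ ⟨f, hf, rfl⟩
  exact hf v trivial

theorem relIndex_branchK_ne_zero : branchK.relIndex grigorchukGroup ≠ 0 := by
  have := grigQuotient_branchK.2
  have h : (levelInGrig 0).FiniteIndex := Subgroup.finiteIndex_of_finite_quotient
  have := h.index_ne_zero
  rwa [levelInGrig, levelSubgroup_zero] at this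

/-- Kₙ sits inside the blocks of the whole group at level n + 1, where Kₙ₊₁ has finite index because
K has finite index in the group. -/
theorem levelInGrig_finiteIndex (n : ℕ) : (levelInGrig n).FiniteIndex := by
  rw [Subgroup.finiteIndex_iff]
  show (levelSubgroup branchK n).relIndex grigorchukGroup ≠ 0
  induction n with
  | zero => rw [levelSubgroup_zero]; exact relIndex_branchK_ne_zero
  | succ n ih =>
    refine Subgroup.relIndex_ne_zero_trans (fun h0 => ?_) ih
    exact relIndex_levelSubgroup_ne_zero relIndex_branchK_ne_zero (n + 1)
      (Subgroup.relIndex_eq_zero_of_le_right (levelSubgroup_branchK_le_grig n) h0)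

/-- A subgroup that contains the generators modulo `K` is dense in the Grigorchuk group. -/
theorem dense_of_generators {H : Subgroup (Equiv.Perm (ℕ → Bool))}
    (hgen : ∀ s, ∃ k ∈ branchK, grigPerm s * k ∈ H) (n : ℕ) {g : Equiv.Perm (ℕ → Bool)}
    (hg : g ∈ grigorchukGroup) : ∃ h ∈ H, ∃ k ∈ levelSubgroup branchK n, g = h * k := by
  have := levelInGrig_finiteIndex n
  have hp : IsPGroup 2 (grigorchukGroup ⧸ levelInGrig n) := by
    intro q
    obtain ⟨x, rfl⟩ := QuotientGroup.mk_surjective q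
    -- Chosen because 2^(2(n+1)) = 4^(n+1).
    refine ⟨2 * (n + 1), ?_⟩
    rw [pow_mul, ← QuotientGroup.mk_pow, QuotientGroup.eq_one_iff]
    exact pow_mem_levelSubgroup x.2 n
  have hnil : Group.IsNilpotent (grigorchukGroup ⧸ levelInGrig n) := hp.isNilpotent
  set π := QuotientGroup.mk' (levelInGrig n) with hπ
  have htop : (H.subgroupOf grigorchukGroup).map π = ⊤ := by
    refine eq_top_of_sup_commutator_eq_top ((Subgroup.eq_top_iff' _).2 fun q => ?_)
    obtain ⟨x, rfl⟩ := QuotientGroup.mk'_surjective _ q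
    refine grigElem_induction (p := fun x => π x ∈ (H.subgroupOf grigorchukGroup).map π ⊔
      commutator (grigorchukGroup ⧸ levelInGrig n)) (by rw [map_one]; exact one_mem _) ?_ x
    intro s x hx
    rw [map_mul]
    refine mul_mem ?_ hx
    obtain ⟨k, hk, hsk⟩ := hgen s
    have hkG := branchK_le hk
    -- The Frattini argument: the perturbation k is invisible modulo commutators.
    have hkc : (⟨k, hkG⟩ : grigorchukGroup) ∈ commutator grigorchukGroup := by
      have := branchK_le_commutator hk
      rw [← Subgroup.map_subtype_commutator] at this
      obtain ⟨y, hy, rfl⟩ := this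
      exact hy
    have e : grigElem s = (grigElem s * ⟨k, hkG⟩) * ⟨k, hkG⟩⁻¹ := by rw [mul_inv_cancel_right]
    rw [e, map_mul, map_inv]
    refine mul_mem (Subgroup.mem_sup_left ⟨_, hsk, rfl⟩) (inv_mem (Subgroup.mem_sup_right ?_))
    have h2 : π ⟨k, hkG⟩ ∈ (commutator grigorchukGroup).map π := ⟨_, hkc, rfl⟩
    rw [commutator_def, Subgroup.map_commutator,
      Subgroup.map_top_of_surjective _ (QuotientGroup.mk'_surjective _)] at h2
    exact h2
  have hmem : π ⟨g, hg⟩ ∈ (H.subgroupOf grigorchukGroup).map π := by rw [htop]; trivial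
  obtain ⟨h, hh, hhg⟩ := hmem
  refine ⟨h, hh, (h : Equiv.Perm (ℕ → Bool))⁻¹ * g, ?_, by rw [mul_inv_cancel_left]⟩
  have := (QuotientGroup.mk'_eq_mk' _).1 hhg
  obtain ⟨z, hz, hz2⟩ := this
  rw [← show (h : Equiv.Perm (ℕ → Bool)) * z = g from congrArg Subtype.val hz2,
    inv_mul_cancel_left]
  exact hz

/-! ### Dense subgroups with full sections -/

/-- Every element of the Grigorchuk group lies in `H` modulo every level subgroup. -/
def IsLevelDense (H : Subgroup (Equiv.Perm (ℕ → Bool))) : Prop :=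
  ∀ n, ∀ g ∈ grigorchukGroup, ∃ h ∈ H, ∃ k ∈ levelSubgroup branchK n, g = h * k

theorem mem_of_blockHom_mem {n : ℕ} {f : (Fin n → Bool) → Equiv.Perm (ℕ → Bool)}
    (hf : blockHom n f ∈ grigorchukGroup) (v : Fin n → Bool) : f v ∈ grigorchukGroup := by
  obtain ⟨u, s, hs, h⟩ := exists_section hf v
  have : f v = s := by
    ext1 ω
    have h2 := h ω
    rw [blockHom_prepend] at h2
    exact (prepend_injective h2).2
  rwa [this]

theorem exists_notMem_levelSubgroup {q : Equiv.Perm (ℕ → Bool)} (hq : q ∈ grigorchukGroup)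
    (h1 : q ≠ 1) : ∃ i, ∀ j, q ∉ levelSubgroup branchK (i + j) := by
  obtain ⟨i, w, u, hne, r, hr, h⟩ := exists_moved_vertex hq h1
  refine ⟨i, fun j hj => hne ?_⟩
  rw [← levelSubgroup_add] at hj
  obtain ⟨f, -, rfl⟩ := mem_levelSubgroup.1 hj
  have h2 := h (fun _ => false)
  rw [blockHom_prepend] at h2
  exact (prepend_injective h2).1.symm

theorem commutator_mem_left {M : Subgroup (Equiv.Perm (ℕ → Bool))}
    (hM : ∀ g ∈ grigorchukGroup, ∀ x ∈ M, g * x * g⁻¹ ∈ M) {x g : Equiv.Perm (ℕ → Bool)}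
    (hx : x ∈ M) (hg : g ∈ grigorchukGroup) : ⁅x, g⁆ ∈ M := by
  have := mul_mem hx (hM g hg _ (inv_mem hx))
  rwa [← mul_assoc, ← mul_assoc] at this

/-- `K` has trivial centraliser in the Grigorchuk group. -/
theorem exists_commutator_ne_one {s : Equiv.Perm (ℕ → Bool)} (hs : s ∈ grigorchukGroup)
    (h1 : s ≠ 1) : ∃ k ∈ branchK, ⁅k, s⁆ ≠ 1 := by
  obtain ⟨n, v, u, huv, r, hr, h⟩ := exists_moved_vertex hs h1
  refine ⟨blockAt v gT, blockAt_mem_branchK v gT_mem, fun h2 => ?_⟩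
  rw [commutatorElement_eq_one_iff_mul_comm] at h2
  have h3 := conj_blockAt h gT hs
  rw [← h2, mul_inv_cancel_right] at h3
  have h4 := congrArg (fun p => p (prepend v fun _ => false)) h3
  simp only [blockAt_same, blockAt_of_ne huv.symm] at h4
  exact gT_apply_ne _ (prepend_injective h4).2

section Dense

variable {H : Subgroup (Equiv.Perm (ℕ → Bool))}

/-- Approximating a lift modulo Kₙ costs only a block-diagonal error: the vertex is still sent to u,
and the section changes by a factor from K. -/
theorem IsLevelDense.exists_lift (hd : IsLevelDense H) {n : ℕ} (v u : Fin n → Bool)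
    {g : Equiv.Perm (ℕ → Bool)} (hg : g ∈ grigorchukGroup) :
    ∃ h ∈ H, ∃ k ∈ branchK, ∀ ω, h (prepend v ω) = prepend u ((g * k) ω) := by
  obtain ⟨r, hr, h1⟩ := _root_.exists_lift hg v u
  obtain ⟨h, hh, k, hk, rfl⟩ := hd n r hr
  obtain ⟨f, hf, rfl⟩ := mem_levelSubgroup.1 hk
  refine ⟨h, hh, (f v)⁻¹, inv_mem (hf v), fun ω => ?_⟩
  have h2 := h1 ((f v)⁻¹ ω)
  rw [Equiv.Perm.mul_apply, blockHom_prepend, perm_apply_inv_self] at h2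
  rw [h2, Equiv.Perm.mul_apply]

/-- If all elements of the Grigorchuk group are sections of elements of `H` at one vertex, then also at
the other vertices of the same level. -/
theorem IsLevelDense.full_sections (hd : IsLevelDense H) {n : ℕ} {v₀ : Fin n → Bool}
    (hv₀ : ∀ g ∈ grigorchukGroup, ∃ h ∈ H, ∀ ω, h (prepend v₀ ω) = prepend v₀ (g ω))
    (v : Fin n → Bool) :
    ∀ g ∈ grigorchukGroup, ∃ h ∈ H, ∀ ω, h (prepend v ω) = prepend v (g ω) := by
  intro g hg
  obtain ⟨r, hr, k, hk, h1⟩ := hd.exists_lift v₀ v (one_mem _)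
  rw [one_mul] at h1
  have hk' := branchK_le hk
  -- The element r that carries v₀ to v has section k, so g is conjugated beforehand to compensate.
  obtain ⟨h, hh, h2⟩ := hv₀ (k⁻¹ * g * k) (mul_mem (mul_mem (inv_mem hk') hg) hk')
  refine ⟨r * h * r⁻¹, mul_mem (mul_mem hr hh) (inv_mem hr), fun ω => ?_⟩
  have h3 : r⁻¹ (prepend v ω) = prepend v₀ (k⁻¹ ω) := by
    rw [Equiv.Perm.inv_eq_iff_eq, h1, perm_apply_inv_self]
  rw [Equiv.Perm.mul_apply, Equiv.Perm.mul_apply, h3, h2, h1, ← Equiv.Perm.mul_apply,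
    ← Equiv.Perm.mul_apply]
  congr 2
  group

/-- Block-diagonal elements of a dense subgroup approximating a given block. -/
theorem IsLevelDense.exists_approx (hd : IsLevelDense H) {n : ℕ} (v : Fin n → Bool)
    {k : Equiv.Perm (ℕ → Bool)} (hk : k ∈ branchK) (j : ℕ) :
    ∃ f : (Fin n → Bool) → Equiv.Perm (ℕ → Bool), blockHom n f ∈ H ∧
      (∃ κ ∈ levelSubgroup branchK j, f v = k * κ) ∧
      ∀ u, u ≠ v → f u ∈ levelSubgroup branchK j := by
  -- At depth n + j the error is block diagonal at level n, with blocks in Kⱼ.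
  obtain ⟨h, hh, κ, hκ, h1⟩ := hd (n + j) (blockAt v k) (branchK_le (blockAt_mem_branchK v hk))
  rw [← levelSubgroup_add] at hκ
  obtain ⟨F, hF, rfl⟩ := mem_levelSubgroup.1 hκ
  refine ⟨Pi.mulSingle v k * F⁻¹, ?_, ⟨(F v)⁻¹, inv_mem (hF v), by simp⟩, fun u hu => ?_⟩
  · rw [map_mul, map_inv, ← blockAt_eq, h1, mul_inv_cancel_right]
    exact hh
  · simpa [Pi.mulSingle_eq_of_ne hu] using hF u

/-- Block-diagonal elements whose block at a given vertex is a given proper power. -/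
theorem exists_pow_section (hH : H ≤ grigorchukGroup) {n : ℕ} {v : Fin n → Bool}
    (hv : ∀ g ∈ grigorchukGroup, ∃ h ∈ H, ∀ ω, h (prepend v ω) = prepend v (g ω))
    {g : Equiv.Perm (ℕ → Bool)} (hg : g ∈ grigorchukGroup) :
    ∃ f : (Fin n → Bool) → Equiv.Perm (ℕ → Bool), blockHom n f ∈ H ∧ f v = g ^ 4 ^ (n + 1) := by
  obtain ⟨h, hh, h1⟩ := hv g hg
  have hpow : ∀ m ω, (h ^ m) (prepend v ω) = prepend v ((g ^ m) ω) := by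
    intro m
    induction m with
    | zero => intro ω; rfl
    | succ m ih =>
      intro ω
      rw [pow_succ, Equiv.Perm.mul_apply, h1, ih, pow_succ, Equiv.Perm.mul_apply]
  obtain ⟨f, -, hf⟩ := mem_levelSubgroup.1 (pow_mem_levelSubgroup (hH hh) n)
  refine ⟨f, by rw [hf]; exact pow_mem hh _, ?_⟩
  ext1 ω
  have h2 := hpow (4 ^ (n + 1)) ω
  rw [← hf, blockHom_prepend] at h2
  exact (prepend_injective h2).2

/-- Non-trivial elements, supported below a set `J` of vertices of some level, lead to non-trivial
elements supported below one vertex. -/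
theorem IsLevelDense.exists_blockAt_mem (hd : IsLevelDense H) (hH : H ≤ grigorchukGroup) {n : ℕ}
    (hv : ∀ v : Fin n → Bool, ∀ g ∈ grigorchukGroup,
      ∃ h ∈ H, ∀ ω, h (prepend v ω) = prepend v (g ω))
    (m : ℕ) (J : Finset (Fin n → Bool)) (hJ : J.card = m)
    (f : (Fin n → Bool) → Equiv.Perm (ℕ → Bool)) (hf : blockHom n f ∈ H) (hf1 : f ≠ 1)
    (hfJ : ∀ v, v ∉ J → f v = 1) : ∃ (v : Fin n → Bool) (s : Equiv.Perm (ℕ → Bool)), s ≠ 1 ∧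
      blockAt v s ∈ H := by
  classical
  induction m generalizing J f with
  | zero =>
    rw [Finset.card_eq_zero] at hJ
    exact (hf1 (funext fun v => hfJ v (by simp [hJ]))).elim
  | succ m ih =>
  obtain ⟨v₁, hv₁⟩ : ∃ v, f v ≠ 1 := Function.ne_iff.1 hf1
  have hv₁J : v₁ ∈ J := by
    by_contra h
    exact hv₁ (hfJ v₁ h)
  by_cases hsingle : ∀ v ≠ v₁, f v = 1
  · refine ⟨v₁, f v₁, hv₁, ?_⟩
    have : Pi.mulSingle v₁ (f v₁) = f := by
      funext v
      by_cases h : v = v₁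
      · subst h; simp
      · rw [Pi.mulSingle_eq_of_ne h, hsingle v h]
    rwa [blockAt_eq, this]
  push Not at hsingle
  obtain ⟨v₂, hv₂, hv₂f⟩ := hsingle
  have hv₂J : v₂ ∈ J := by
    by_contra h
    exact hv₂f (hfJ v₂ h)
  have hfG : ∀ {f}, blockHom n f ∈ H → ∀ v, f v ∈ grigorchukGroup := fun h v =>
    mem_of_blockHom_mem (hH h) v
  obtain ⟨k, hk, hkne⟩ := exists_commutator_ne_one (hfG hf v₁) hv₁
  have hcG : ⁅k, f v₁⁆ ∈ grigorchukGroup := by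
    have hkG := branchK_le hk
    have hfv := hfG hf v₁
    exact mul_mem (mul_mem (mul_mem hkG hfv) (inv_mem hkG)) (inv_mem hfv)
  obtain ⟨c, w, u, huw, r, hr, hcw⟩ := exists_moved_vertex hcG hkne
  obtain ⟨k₁, hk₁, k₂, hk₂, hne⟩ := exists_commutator_pow_ne_one (N := 4 ^ (n + 1)) (by positivity)
  obtain ⟨φ₁, hφ₁, hφ₁v⟩ := exists_pow_section hH (hv v₁)
    (branchK_le (blockAt_mem_branchK w (inv_mem hk₁)))
  obtain ⟨φ₂, hφ₂, hφ₂v⟩ := exists_pow_section hH (hv v₁) (branchK_le (blockAt_mem_branchK w hk₂))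
  -- A family in H, with support still in J, whose block at v₁ is a fixed non-trivial element while
  -- its block at v₂ is as deep as desired. It is a triple commutator: e approximates k at v₁ and is
  -- nearly trivial elsewhere, and φ₁, φ₂ have prescribed powers as blocks at v₁.
  have main : ∀ j, ∃ g : (Fin n → Bool) → Equiv.Perm (ℕ → Bool), blockHom n g ∈ H ∧
      g v₁ = blockAt w ⁅k₁ ^ 4 ^ (n + 1), k₂ ^ 4 ^ (n + 1)⁆ ∧
      g v₂ ∈ levelSubgroup branchK (c + j) ∧ ∀ v, v ∉ J → g v = 1 := by
    intro j
    obtain ⟨e, he, ⟨κ, hκ, hev⟩, hev₂⟩ := hd.exists_approx v₁ hk (c + j)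
    have hcomm : ∀ {x y}, blockHom n x ∈ H → blockHom n y ∈ H → blockHom n ⁅x, y⁆ ∈ H := by
      intro x y hx hy
      rw [map_commutatorElement]
      exact mul_mem (mul_mem (mul_mem hx hy) (inv_mem hx)) (inv_mem hy)
    have hcv : ∀ (x y : (Fin n → Bool) → Equiv.Perm (ℕ → Bool)) v, ⁅x, y⁆ v = ⁅x v, y v⁆ :=
      fun _ _ _ => rfl
    refine ⟨⁅⁅⁅e, f⁆, φ₁⁆, φ₂⁆, hcomm (hcomm (hcomm he hf) hφ₁) hφ₂, ?_, ?_, ?_⟩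
    -- The approximation error is trivial on the first c letters, so the block still sends w to u;
    -- the double commutator identity then leaves an exact block, free of error.
    · obtain ⟨s, hs⟩ : ∃ s : Equiv.Perm (ℕ → Bool), ∀ ω, ⁅e, f⁆ v₁ (prepend w ω) = prepend u (s ω) := by
        have hn := conj_mem_levelSubgroup_branchK (c + j)
        have hh := hfG hf v₁
        have hκ3 : f v₁ * (k * ((f v₁)⁻¹ * κ * f v₁ * κ⁻¹) * k⁻¹) * (f v₁)⁻¹ ∈
            levelSubgroup branchK (c + j) := by
          refine hn _ hh _ (hn _ (branchK_le hk) _ (mul_mem ?_ (inv_mem hκ)))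
          have := hn _ (inv_mem hh) _ hκ
          rwa [inv_inv] at this
        rw [← levelSubgroup_add] at hκ3
        obtain ⟨F, hF, hF2⟩ := mem_levelSubgroup.1 hκ3
        refine ⟨r * F w, fun ω => ?_⟩
        have e1 : ⁅e, f⁆ v₁ = ⁅k, f v₁⁆ * blockHom c F := by
          rw [hF2, hcv, hev, commutatorElement_def, commutatorElement_def]
          group
        rw [e1, Equiv.Perm.mul_apply, blockHom_prepend, hcw, Equiv.Perm.mul_apply]
      have hG : ⁅e, f⁆ v₁ ∈ grigorchukGroup := hfG (hcomm he hf) v₁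
      rw [hcv, hcv, hφ₁v, hφ₂v, ← map_pow, ← map_pow, commutator_commutator_eq]
      · rw [← map_inv, ← map_commutatorElement, inv_pow, inv_inv]
      · rw [conj_blockAt hs _ hG]; exact blockAt_commute huw _ _
      · rw [conj_blockAt hs _ hG]; exact blockAt_commute huw _ _
    · have hn := conj_mem_levelSubgroup_branchK (c + j)
      exact commutator_mem_left hn (commutator_mem_left hn (commutator_mem_left hn
        (hev₂ v₂ hv₂) (hfG hf v₂)) (hfG hφ₁ v₂)) (hfG hφ₂ v₂)
    · intro v hvJ
      rw [hcv, hcv, hcv, hfJ v hvJ]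
      simp
  have hCne : blockAt w ⁅k₁ ^ 4 ^ (n + 1), k₂ ^ 4 ^ (n + 1)⁆ ≠ 1 := fun h =>
    hne (blockAt_injective w (h.trans (map_one _).symm))
  obtain ⟨g, hg, hg₁, hg₂, hgJ⟩ := main 0
  have herase : ∀ {v}, v ∈ J → (J.erase v).card = m := fun h => by
    rw [Finset.card_erase_of_mem h, hJ, Nat.add_sub_cancel]
  -- If the block at v₂ is trivial, v₂ leaves the support. Otherwise dividing by a member of the
  -- family that is deeper at v₂ cancels the block at v₁ but not the one at v₂, so v₁ leaves.
  by_cases hq : g v₂ = 1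
  · refine ih (J.erase v₂) (herase hv₂J) g hg (fun h => hCne ?_) fun v hv => ?_
    · rw [← hg₁, h]; rfl
    · by_cases h : v = v₂
      · rw [h, hq]
      · exact hgJ v fun h2 => hv (Finset.mem_erase.2 ⟨h, h2⟩)
  · obtain ⟨i, hi⟩ := exists_notMem_levelSubgroup (hfG hg v₂) hq
    obtain ⟨g', hg', hg₁', hg₂', hgJ'⟩ := main i
    refine ih (J.erase v₁) (herase hv₁J) (g * g'⁻¹) ?_ (fun h => ?_) fun v hv => ?_
    · rw [map_mul, map_inv]; exact mul_mem hg (inv_mem hg')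
    · rw [mul_inv_eq_one] at h
      rw [← h, add_comm] at hg₂'
      exact hi c hg₂'
    · by_cases h : v = v₁
      · rw [h, Pi.mul_apply, Pi.inv_apply, hg₁, hg₁', mul_inv_cancel]
      · have hvJ : v ∉ J := fun h2 => hv (Finset.mem_erase.2 ⟨h, h2⟩)
        rw [Pi.mul_apply, Pi.inv_apply, hgJ v hvJ, hgJ' v hvJ, mul_inv_cancel]

/-- A dense subgroup of the Grigorchuk group whose sections at some vertex are all of the Grigorchuk
group is the Grigorchuk group. -/
theorem IsLevelDense.eq_grigorchukGroup (hd : IsLevelDense H) (hH : H ≤ grigorchukGroup) {n : ℕ}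
    {v₀ : Fin n → Bool}
    (hv₀ : ∀ g ∈ grigorchukGroup, ∃ h ∈ H, ∀ ω, h (prepend v₀ ω) = prepend v₀ (g ω)) :
    H = grigorchukGroup := by
  classical
  have hv := hd.full_sections hv₀
  obtain ⟨v, s, hs, hsH⟩ : ∃ (v : Fin n → Bool) (s : Equiv.Perm (ℕ → Bool)), s ≠ 1 ∧
      blockAt v s ∈ H := by
    -- A non-trivial block-diagonal element to start from: the power of k₁ is non-trivial, as it
    -- does not commute with that of k₂.
    obtain ⟨k₁, hk₁, k₂, hk₂, hne⟩ := exists_commutator_pow_ne_one (N := 4 ^ (n + 1)) (by positivity)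
    obtain ⟨f, hf, hfv⟩ := exists_pow_section hH (hv v₀) (branchK_le hk₁)
    refine hd.exists_blockAt_mem hH hv _ Finset.univ rfl f hf (fun h => hne ?_) (by simp)
    rw [← hfv, h, Pi.one_apply, commutatorElement_one_left]
  -- Because every element is a section of H at v, the elements that H contains as isolated blocks
  -- at v form a normalised subgroup; being non-trivial, it contains some Kₘ. Density then spreads
  -- this to all vertices of the level.
  have hM : ∀ g ∈ grigorchukGroup, ∀ x ∈ H.comap (blockAt v), g * x * g⁻¹ ∈ H.comap (blockAt v) := by
    intro g hg x hx
    obtain ⟨h, hh, h1⟩ := hv v g hg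
    rw [Subgroup.mem_comap, ← conj_blockAt h1 x (hH hh)]
    exact mul_mem (mul_mem hh hx) (inv_mem hh)
  have hsG : s ∈ grigorchukGroup := by
    have := mem_of_blockHom_mem (hH hsH) v
    simpa using this
  obtain ⟨m, hm⟩ := exists_levelSubgroup_le hM hsG hsH hs
  have hle : levelSubgroup branchK (n + m) ≤ H := by
    rw [← levelSubgroup_add]
    refine levelSubgroup_le fun u k hk => ?_
    obtain ⟨h, hh, l, hl, h1⟩ := hd.exists_lift v u (one_mem _)
    rw [one_mul] at h1
    have h2 := conj_mem_levelSubgroup_branchK m _ (inv_mem (branchK_le hl)) k hk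
    have h3 := mul_mem (mul_mem hh (hm h2)) (inv_mem hh)
    rw [conj_blockAt h1 _ (hH hh)] at h3
    convert h3 using 2
    group
  refine le_antisymm hH fun g hg => ?_
  obtain ⟨h, hh, k, hk, rfl⟩ := hd (n + m) g hg
  exact mul_mem hh (hle hk)

end Dense

/-! ### Generating triples of large girth -/

theorem grigorchukGroup_eq_closure_range_grigElem :
    Subgroup.closure (Set.range grigElem) = ⊤ := by
  rw [Subgroup.eq_top_iff']
  exact grigElem_induction (one_mem _) fun s g hg => mul_mem (Subgroup.subset_closure ⟨s, rfl⟩) hg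

instance grigGen_finite : Finite GrigGen :=
  Finite.of_surjective (fun i : Fin 4 => (![.a, .b, .c, .d] : Fin 4 → GrigGen) i) fun s => by
    cases s
    exacts [⟨0, rfl⟩, ⟨1, rfl⟩, ⟨2, rfl⟩, ⟨3, rfl⟩]

instance grigorchukGroup_fg : Group.FG grigorchukGroup :=
  ⟨(Subgroup.fg_iff _).2 ⟨_, grigorchukGroup_eq_closure_range_grigElem, Set.finite_range _⟩⟩

theorem grigorchukGroup_countable : Countable grigorchukGroup := by
  have h : Function.Surjective (FreeGroup.lift grigElem) := by
    rw [← MonoidHom.range_eq_top, FreeGroup.range_lift_eq_closure]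
    exact grigorchukGroup_eq_closure_range_grigElem
  exact h.countable

/-- The group is countable, so orbits are, whereas by Cantor's diagonal the set of sequences is not.
-/
theorem infinite_compl_orbit (ξ : ℕ → Bool) : {p | ∀ g ∈ grigorchukGroup, g ξ ≠ p}.Infinite := by
  intro hfin
  have := grigorchukGroup_countable
  have h1 : (Set.range fun g : grigorchukGroup => (g : Equiv.Perm (ℕ → Bool)) ξ).Countable :=
    Set.countable_range _
  have h2 : (Set.univ : Set (ℕ → Bool)).Countable := by
    refine (hfin.countable.union h1).mono fun p _ => ?_
    by_cases hp : ∀ g ∈ grigorchukGroup, g ξ ≠ p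
    · exact Or.inl hp
    · push Not at hp
      obtain ⟨g, hg, rfl⟩ := hp
      exact Or.inr ⟨⟨g, hg⟩, rfl⟩
  rw [Set.countable_univ_iff] at h2
  obtain ⟨f, hf⟩ := exists_surjective_nat (ℕ → Bool)
  obtain ⟨n, hn⟩ := hf fun n => !f n n
  have := congrFun hn n
  simp at this

/-- Sections of products with a block, where the first factor is locally an involution. -/
theorem section_of_local_involution {s α t : Equiv.Perm (ℕ → Bool)} (hs : s ∈ grigorchukGroup)
    (hs2 : s * s = 1) {j : ℕ} {v : Fin j → Bool}
    (hα : ∀ ω, α (prepend v ω) = prepend v ω)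
    (hα' : ∀ ω, α (s (prepend v ω)) = s (prepend v ω)) {ω₀ : ℕ → Bool}
    (hne : seqInit j (s (prepend v ω₀)) ≠ v) (ω : ℕ → Bool) :
    ((s * α * blockAt v t) * (s * α * blockAt v t)) (prepend v ω) = prepend v (t ω) := by
  obtain ⟨u, r, -, h⟩ := exists_section hs v
  have huv : u ≠ v := by
    rintro rfl
    rw [h, seqInit_prepend] at hne
    exact hne rfl
  have hss : ∀ p, s (s p) = p := fun p => by rw [← Equiv.Perm.mul_apply, hs2]; rfl
  simp only [Equiv.Perm.mul_apply]
  rw [blockAt_same, hα, h, blockAt_of_ne huv, ← h, hα', hss]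

/-- The two modifications of a, b, d have disjoint purposes. The generic one, off the orbit of ξ,
prevents short relations; the one at a long prefix of ξ supplies sections that force generation, and
avoids all points used by the first. -/
theorem exists_generating_triple (R : ℕ) : ∃ x : Fin 3 → Equiv.Perm (ℕ → Bool),
    Subgroup.closure (Set.range x) = grigorchukGroup ∧
    ∀ w : List (Fin 3 × Bool), FreeGroup.IsReduced w → w ≠ [] → w.length ≤ R →
      FreeGroup.lift x (FreeGroup.mk w) ≠ 1 := by
  classical
  set ξ : ℕ → Bool := fun _ => false with hξ
  -- Near these points the generic perturbation must be trivial, so that squares can be computed at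
  -- ξ; d contributes no new point since it fixes ξ.
  set B : Finset (ℕ → Bool) := {ξ, gA ξ, gB ξ} with hB
  set O : Set (ℕ → Bool) := {p | ∀ g ∈ grigorchukGroup, g ξ ≠ p} with hO
  set x₀ : Fin 3 → Equiv.Perm (ℕ → Bool) := ![gA, gB, gD] with hx₀
  have hx₀G : ∀ i, x₀ i ∈ grigorchukGroup := by
    intro i
    fin_cases i <;> exact grigPerm_mem _
  have hOinv : ∀ g ∈ grigorchukGroup, ∀ p ∈ O, g p ∈ O := by
    intro g hg p hp h hh heq
    refine hp (g⁻¹ * h) (mul_mem (inv_mem hg) hh) ?_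
    rw [Equiv.Perm.mul_apply, heq, perm_inv_apply_self]
  have hξO : ξ ∉ O := fun h => h 1 (one_mem _) rfl
  have hBO : ∀ p ∈ O, p ∉ B := by
    intro p hp hpB
    simp only [hB, Finset.mem_insert, Finset.mem_singleton] at hpB
    rcases hpB with rfl | rfl | rfl
    · exact hξO hp
    · exact hp gA (grigPerm_mem _) rfl
    · exact hp gB (grigPerm_mem _) rfl
  have hWfin : {w : List (Fin 3 × Bool) |
      w.length ≤ R ∧ FreeGroup.IsReduced w ∧ w ≠ []}.Finite :=
    (List.finite_length_le _ R).subset fun w hw => hw.1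
  obtain ⟨x, E, h1, h2, h3⟩ := exists_generic_tuple (separates_germStabilizer B hBO)
    (fun g hg p hp => hOinv g (branchK_le hg.1) p hp) (infinite_compl_orbit ξ) hWfin.toFinset.toList
    (fun w hw => by
      rw [Finset.mem_toList, Set.Finite.mem_toFinset] at hw
      exact hw.2) x₀
    (fun i p => ⟨fun h => by
      have := hOinv _ (inv_mem (hx₀G i)) _ h
      rwa [perm_inv_apply_self] at this, fun h => hOinv _ (hx₀G i) p h⟩)
  choose m hm using fun i => (h1 i).2
  obtain ⟨l, hl⟩ := exists_seqInit_ne (Finset.univ.biUnion E) (p := ξ) (by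
    simp only [Finset.mem_biUnion, Finset.mem_univ, true_and, not_exists]
    exact fun i hi => hξO (h2 i ξ hi))
  -- The prefix must be long enough for the perturbations to be trivial below it, long enough to
  -- separate ξ from all committed points, and of length at least 2, as aξ and bξ differ from ξ in
  -- the first and in the second letter.
  set j := Finset.univ.sup m + l + 2 with hj
  set v : Fin j → Bool := seqInit j ξ with hv
  set t : Fin 3 → Equiv.Perm (ℕ → Bool) := ![gT, pair gT 1, pair 1 gT] with ht
  have htK : ∀ i, t i ∈ branchK := by
    intro i
    fin_cases i
    exacts [gT_mem, pair_gT_one_mem, pair_one_gT_mem]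
  set x' : Fin 3 → Equiv.Perm (ℕ → Bool) := fun i => x i * blockAt v (t i) with hx'
  have hx'eq : ∀ i, x' i = x₀ i * ((x₀ i)⁻¹ * x i) * blockAt v (t i) := fun i => by
    rw [mul_inv_cancel_left]
  have hx'K : ∀ i, ∃ k ∈ branchK, x' i = x₀ i * k := fun i =>
    ⟨(x₀ i)⁻¹ * x i * blockAt v (t i), mul_mem (h1 i).1 (blockAt_mem_branchK v (htK i)), by
      rw [hx'eq, mul_assoc]⟩
  set H := Subgroup.closure (Set.range x') with hH
  have hx'H : ∀ i, x' i ∈ H := fun i => Subgroup.subset_closure ⟨i, rfl⟩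
  have hHG : H ≤ grigorchukGroup := by
    refine (Subgroup.closure_le _).2 ?_
    rintro _ ⟨i, rfl⟩
    obtain ⟨k, hk, h⟩ := hx'K i
    rw [h]
    exact mul_mem (hx₀G i) (branchK_le hk)
  have hdense : IsLevelDense H := by
    refine fun n g hg => dense_of_generators (fun s => ?_) n hg
    obtain ⟨k₀, hk₀, e₀⟩ := hx'K 0
    obtain ⟨k₁, hk₁, e₁⟩ := hx'K 1
    obtain ⟨k₂, hk₂, e₂⟩ := hx'K 2
    cases s with
    | a => exact ⟨k₀, hk₀, e₀ ▸ hx'H 0⟩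
    | b => exact ⟨k₁, hk₁, e₁ ▸ hx'H 1⟩
    | d => exact ⟨k₂, hk₂, e₂ ▸ hx'H 2⟩
    | c =>
      -- The product of the perturbed b and d, rewritten with c = bd and the normality of K.
      refine ⟨gD * k₁ * gD * k₂, mul_mem (gD_conj_branchK hk₁) hk₂, ?_⟩
      have : gC * (gD * k₁ * gD * k₂) = x' 1 * x' 2 := by
        rw [e₁, e₂]
        show _ = gB * k₁ * (gD * k₂)
        simp only [mul_assoc, gC_mul_gD_mul]
      show gC * _ ∈ H
      rw [this]
      exact mul_mem (hx'H 1) (hx'H 2)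
  have hinit : ∀ i (p q : ℕ → Bool), seqInit j p = seqInit j q → seqInit (m i) p = seqInit (m i) q := by
    intro i p q h
    funext y
    have : m i ≤ Finset.univ.sup m := Finset.le_sup (Finset.mem_univ i)
    exact congrFun h ⟨y, by omega⟩
  have hα : ∀ i, ∀ f ∈ B, ∀ ω, seqInit j ω = seqInit j f → ((x₀ i)⁻¹ * x i) ω = ω :=
    fun i f hf ω h => hm i f hf ω (hinit i _ _ h)
  have hpre : ∀ g ∈ grigorchukGroup, ∀ ω, seqInit j (g (prepend v ω)) = seqInit j (g ξ) := by
    intro g hg ω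
    obtain ⟨u, r, -, h⟩ := exists_section hg v
    have : ξ = prepend v (seqDrop j ξ) := (prepend_init_drop j ξ).symm
    rw [this, h, h, seqInit_prepend, seqInit_prepend]
  have hsec : ∀ i, ∃ h ∈ H, ∀ ω, h (prepend v ω) = prepend v (t i ω) := by
    have hαv : ∀ i ω, ((x₀ i)⁻¹ * x i) (prepend v ω) = prepend v ω := fun i ω =>
      hα i ξ (by simp [hB]) _ (by rw [seqInit_prepend])
    have hinv : ∀ i, x₀ i * x₀ i = 1 → x₀ i ξ ∈ B → seqInit j (x₀ i ξ) ≠ v →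
        ∃ h ∈ H, ∀ ω, h (prepend v ω) = prepend v (t i ω) := by
      intro i hi hiB hne
      refine ⟨x' i * x' i, mul_mem (hx'H i) (hx'H i), fun ω => ?_⟩
      rw [hx'eq]
      refine section_of_local_involution (hx₀G i) hi (hαv i)
        (fun ω => hα i _ hiB _ (hpre _ (hx₀G i) ω)) (ω₀ := ξ) ?_ ω
      rw [hpre _ (hx₀G i)]
      exact hne
    intro i
    fin_cases i
    · refine hinv 0 gA_mul_self (by simp [hB, hx₀]) fun h => ?_
      have := congrFun h ⟨0, by omega⟩
      simp [seqInit, hv, hx₀, grigPerm_apply, grigAct, hξ] at this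
    · refine hinv 1 gB_mul_self (by simp [hB, hx₀]) fun h => ?_
      have := congrFun h ⟨1, by omega⟩
      simp [seqInit, hv, hx₀, grigPerm_apply, grigAct, hξ, seqTail] at this
    -- Every sequence starting with 0 is fixed by d, so the third letter itself, unsquared, already
    -- has the planted section.
    · refine ⟨x' 2, hx'H 2, fun ω => ?_⟩
      rw [hx'eq, Equiv.Perm.mul_apply, blockAt_same, Equiv.Perm.mul_apply, hαv]
      obtain ⟨y, hy⟩ : ∃ y, prepend v (t 2 ω) = seqCons false y := by
        refine ⟨_, (?_ : _ = seqCons false (seqTail (prepend v (t 2 ω))))⟩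
        conv_lhs => rw [← seqCons_head_tail (prepend v (t 2 ω))]
        congr 1
      show gD (prepend v (t 2 ω)) = _
      rw [hy]
      exact (grigAct_d_cons y).1.trans hy.symm
  have hsecK : ∀ k ∈ branchK, ∃ h ∈ H, ∀ ω, h (prepend v ω) = prepend v (k ω) := by
    intro k hk
    induction hk using Subgroup.closure_induction with
    | mem y hy =>
      rcases hy with rfl | rfl | rfl
      exacts [hsec 0, hsec 1, hsec 2]
    | one => exact ⟨1, one_mem _, fun _ => rfl⟩
    | mul y z _ _ hy hz =>
      obtain ⟨h, hh, e1⟩ := hy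
      obtain ⟨g, hg, e2⟩ := hz
      exact ⟨h * g, mul_mem hh hg, fun ω => by
        rw [Equiv.Perm.mul_apply, e2, e1, Equiv.Perm.mul_apply]⟩
    | inv y _ hy =>
      obtain ⟨h, hh, e1⟩ := hy
      exact ⟨h⁻¹, inv_mem hh, fun ω => by
        rw [Equiv.Perm.inv_eq_iff_eq, e1, perm_apply_inv_self]⟩
  refine ⟨x', hdense.eq_grigorchukGroup hHG (v₀ := v) fun g hg => ?_, fun w hw1 hw2 hw3 => ?_⟩
  -- Density realises g as a section up to a factor from K, and the planted generators correct that
  -- factor.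
  · obtain ⟨h, hh, k, hk, e1⟩ := hdense.exists_lift v v hg
    obtain ⟨h', hh', e2⟩ := hsecK _ (inv_mem hk)
    refine ⟨h * h', mul_mem hh hh', fun ω => ?_⟩
    rw [Equiv.Perm.mul_apply, e2, e1, Equiv.Perm.mul_apply, perm_apply_inv_self]
  · refine h3 x' (fun i y hy => ?_) w (by
      rw [Finset.mem_toList, Set.Finite.mem_toFinset]; exact ⟨hw3, hw1, hw2⟩)
    rw [hx', Equiv.Perm.mul_apply, blockAt_of_init_ne]
    exact hl j (by omega) y (Finset.mem_biUnion.2 ⟨i, Finset.mem_univ i, hy⟩)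

/-! ### Cayley graphs without short cycles -/

theorem pathEnd_eq_lift {ι G : Type*} [Group G] {S : Finset G} {x : ι → G} (f : ι ≃ S) (hf : ∀ i, (f i : G) = x i)
    (L : List (S × Bool)) :
    pathEnd S L = FreeGroup.lift x (FreeGroup.mk (L.map fun p => (f.symm p.1, p.2))) := by
  unfold pathEnd
  rw [← FreeGroup.map.mk]
  have : (fun s : S => (s : G)) = x ∘ f.symm := by
    funext s
    rw [Function.comp_apply, ← hf, Equiv.apply_symm_apply]
  rw [this, FreeGroup.lift_mk, FreeGroup.map.mk, FreeGroup.lift_mk, List.map_map]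
  rfl

section ShortRelations

variable {ι G H : Type*} [DecidableEq ι] [Group G] [Group H]

/-- No non-trivial reduced word of length at most `R` in the elements `x i` represents `1`. -/
def NoShortRelation (x : ι → G) (R : ℕ) : Prop :=
  ∀ w : FreeGroup ι, w.norm ≤ R → FreeGroup.lift x w = 1 → w = 1

theorem mem_cayleyBall_iff {S : Finset G} {x : ι → G} (f : ι ≃ S) (hf : ∀ i, (f i : G) = x i)
    {R : ℕ} {g : G} :
    g ∈ cayleyBall S R ↔ ∃ w : FreeGroup ι, w.norm ≤ R ∧ FreeGroup.lift x w = g := by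
  constructor
  · rintro ⟨L, hL, rfl⟩
    refine ⟨_, FreeGroup.norm_mk_le.trans ?_, (pathEnd_eq_lift f hf L).symm⟩
    rwa [List.length_map]
  · rintro ⟨w, hw, rfl⟩
    refine ⟨w.toWord.map fun p => (f p.1, p.2), by rwa [List.length_map], ?_⟩
    rw [pathEnd_eq_lift f hf, List.map_map]
    conv_rhs => rw [← FreeGroup.mk_toWord (x := w)]
    congr 2
    refine (List.map_congr_left fun p _ => ?_).trans (List.map_id _)
    simp

theorem NoShortRelation.mono {x : ι → G} {m n : ℕ} (h : NoShortRelation x n) (hmn : m ≤ n) :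
    NoShortRelation x m := fun w hw => h w (hw.trans hmn)

theorem NoShortRelation.eq_of_lift_eq {x : ι → G} {R : ℕ} (h : NoShortRelation x R)
    {u v : FreeGroup ι} (huv : u.norm + v.norm ≤ R) (heq : FreeGroup.lift x u = FreeGroup.lift x v) :
    u = v := by
  refine inv_mul_eq_one.1 (h _ ((FreeGroup.norm_mul_le _ _).trans ?_) ?_)
  · rwa [FreeGroup.norm_inv_eq]
  · rw [map_mul, map_inv, heq, inv_mul_cancel]

theorem NoShortRelation.injective {x : ι → G} {R : ℕ} (h : NoShortRelation x R) (hR : 2 ≤ R) :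
    Function.Injective x := by
  intro i j hij
  refine FreeGroup.of_injective (h.eq_of_lift_eq ?_ (by simpa using hij))
  rwa [FreeGroup.norm_of, FreeGroup.norm_of]

/-- Balls of small radius are in bijection with balls in the free group. -/
noncomputable def ballEquiv {S : Finset G} {x : ι → G} (f : ι ≃ S) (hf : ∀ i, (f i : G) = x i) {R : ℕ}
    (h : NoShortRelation x (2 * R + 1)) : {w : FreeGroup ι // w.norm ≤ R} ≃ cayleyBall S R :=
  Equiv.ofBijective (fun w => ⟨FreeGroup.lift x w, (mem_cayleyBall_iff f hf).2 ⟨w, w.2, rfl⟩⟩)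
    ⟨fun u v huv => Subtype.ext (h.eq_of_lift_eq (by have := u.2; have := v.2; omega)
      (congrArg Subtype.val huv)), fun g => by
        obtain ⟨w, hw, h⟩ := (mem_cayleyBall_iff f hf).1 g.2
        exact ⟨⟨w, hw⟩, Subtype.ext h⟩⟩

/-- An edge between two points of the ball closes up to a relation of length at most R + 1 + R. -/
theorem NoShortRelation.lift_eq_mul_iff {x : ι → G} {R : ℕ} (h : NoShortRelation x (2 * R + 1))
    {u v : FreeGroup ι} (hu : u.norm ≤ R) (hv : v.norm ≤ R) (i : ι) :
    FreeGroup.lift x v = FreeGroup.lift x u * x i ↔ v = u * FreeGroup.of i := by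
  constructor
  · intro heq
    refine h.eq_of_lift_eq ?_ (by rw [heq, map_mul, FreeGroup.lift_apply_of])
    have := FreeGroup.norm_mul_le u (FreeGroup.of i)
    rw [FreeGroup.norm_of] at this
    omega
  · rintro rfl
    rw [map_mul, FreeGroup.lift_apply_of]

theorem markedBallsIso_of_noShortRelation {S : Finset G} {T : Finset H} {x : ι → G} {y : ι → H}
    (f : ι ≃ S) (hf : ∀ i, (f i : G) = x i) (f' : ι ≃ T) (hf' : ∀ i, (f' i : H) = y i) {R : ℕ}
    (hx : NoShortRelation x (2 * R + 1)) (hy : NoShortRelation y (2 * R + 1)) :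
    MarkedBallsIso S T (f.symm.trans f') R := by
  refine ⟨(ballEquiv f hf hx).symm.trans (ballEquiv f' hf' hy), fun g hg => ?_, fun g k s => ?_⟩
  · obtain ⟨w, rfl⟩ := (ballEquiv f hf hx).surjective g
    rw [Equiv.trans_apply, Equiv.symm_apply_apply]
    have : (w : FreeGroup ι) = 1 := hx _ (w.2.trans (by omega)) hg
    show FreeGroup.lift y w = 1
    rw [this, map_one]
  · obtain ⟨u, rfl⟩ := (ballEquiv f hf hx).surjective g
    obtain ⟨v, rfl⟩ := (ballEquiv f hf hx).surjective k
    obtain ⟨i, rfl⟩ := f.surjective s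
    simp only [Equiv.trans_apply, Equiv.symm_apply_apply, hf, hf']
    exact (hx.lift_eq_mul_iff u.2 v.2 i).trans (hy.lift_eq_mul_iff u.2 v.2 i).symm

theorem le_cayleyGirth_of_noShortRelation {S : Finset G} {x : ι → G}
    (f : ι ≃ S) (hf : ∀ i, (f i : G) = x i) {R : ℕ} (hx : NoShortRelation x R) :
    (R : ℕ∞) ≤ cayleyGirth S := by
  refine le_iInf₂ fun L ⟨hne, hred, h1⟩ => ?_
  by_contra! hlt
  have hL : L.length < R := by exact_mod_cast hlt
  classical
  rw [pathEnd_eq_lift f hf] at h1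
  have h2 := hx _ (FreeGroup.norm_mk_le.trans (by rw [List.length_map]; omega)) h1
  rw [← FreeGroup.map.mk, ← map_one (FreeGroup.map f.symm)] at h2
  have h3 := FreeGroup.map_injective f.symm.injective h2
  rw [← FreeGroup.toWord_eq_nil_iff, FreeGroup.toWord_mk, hred.reduce_eq] at h3
  exact hne h3

end ShortRelations

theorem noShortRelation_of {ι : Type*} [DecidableEq ι] (R : ℕ) :
    NoShortRelation (FreeGroup.of : ι → FreeGroup ι) R := fun w _ h => by
  rwa [FreeGroup.lift_of_eq_id] at h

/-- The finite set of values of an injective tuple. -/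
theorem exists_finset_equiv {ι G : Type*} [Fintype ι] {x : ι → G} (hx : Function.Injective x) :
    ∃ (S : Finset G) (f : ι ≃ S), (∀ i, (f i : G) = x i) ∧ (S : Set G) = Set.range x := by
  classical
  refine ⟨Finset.univ.map ⟨x, hx⟩, Equiv.ofBijective (fun i => ⟨x i, by simp⟩)
    ⟨fun i j h => hx (congrArg Subtype.val h), ?_⟩, fun i => rfl, by simp⟩
  rintro ⟨s, hs⟩
  obtain ⟨i, -, rfl⟩ := Finset.mem_map.1 hs
  exact ⟨i, rfl⟩

theorem exists_generating_triple_noShortRelation (R : ℕ) : ∃ x : Fin 3 → grigorchukGroup,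
    Subgroup.closure (Set.range x) = ⊤ ∧ NoShortRelation x R := by
  obtain ⟨x, hx, hrel⟩ := exists_generating_triple R
  have hmem : ∀ i, x i ∈ grigorchukGroup := fun i => hx ▸ Subgroup.subset_closure ⟨i, rfl⟩
  refine ⟨fun i => ⟨x i, hmem i⟩, ?_, fun w hw h => ?_⟩
  · apply Subgroup.map_injective grigorchukGroup.subtype_injective
    rw [MonoidHom.map_closure, ← Set.range_comp, ← MonoidHom.range_eq_map, Subgroup.range_subtype]
    exact hx
  · by_contra hne
    refine hrel w.toWord FreeGroup.isReduced_toWord (mt FreeGroup.toWord_eq_nil_iff.1 hne) hw ?_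
    rw [FreeGroup.mk_toWord]
    have h2 := congrArg grigorchukGroup.subtype h
    rw [map_one, ← MonoidHom.comp_apply] at h2
    rw [← h2]
    exact (FreeGroup.lift_unique _ fun i => by simp).symm

theorem exists_generating_finset_noShortRelation (R : ℕ) :
    ∃ (x : Fin 3 → grigorchukGroup) (S : Finset grigorchukGroup) (f : Fin 3 ≃ S),
      (∀ i, (f i : grigorchukGroup) = x i) ∧ IsGenerating S ∧ NoShortRelation x R := by
  -- The extra 2 guarantees that the three generators are distinct even for small `R`.
  obtain ⟨x, hx, hrel⟩ := exists_generating_triple_noShortRelation (R + 2)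
  obtain ⟨S, f, hf, hS⟩ := exists_finset_equiv (hrel.injective (by omega))
  exact ⟨x, S, f, hf, by rw [IsGenerating, hS, hx], hrel.mono (by omega)⟩

theorem grigorchukGroup_preforms : Preforms grigorchukGroup (FreeGroup (Fin 3)) := by
  obtain ⟨T, f', hf', hT⟩ := exists_finset_equiv (FreeGroup.of_injective (α := Fin 3))
  choose x S f hf hS hrel using exists_generating_finset_noShortRelation
  refine ⟨T, by rw [IsGenerating, hT, FreeGroup.closure_range_of], S, hS,
    fun n => (f n).symm.trans f', fun R => ?_⟩
  filter_upwards [eventually_ge_atTop (2 * R + 1)] with n hn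
  exact markedBallsIso_of_noShortRelation (f n) (hf n) f' hf' ((hrel n).mono hn)
    (noShortRelation_of _)

theorem grigorchukGroup_hasInfiniteGirth : HasInfiniteGirth grigorchukGroup := by
  rw [HasInfiniteGirth, ENat.eq_top_iff_forall_ge]
  intro n
  obtain ⟨x, S, f, hf, hS, hrel⟩ := exists_generating_finset_noShortRelation n
  exact le_iSup₂_of_le S hS (le_cayleyGirth_of_noShortRelation f hf hrel)

/-- In a virtually cyclic group, powers of a suitable fixed exponent commute. -/
theorem IsVirtuallyCyclic.exists_pow_commute {G : Type*} [Group G] (h : IsVirtuallyCyclic G) :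
    ∃ N, 0 < N ∧ ∀ x y : G, Commute (x ^ N) (y ^ N) := by
  obtain ⟨C, hC, hfin⟩ := h
  have hmem : ∀ x : G, x ^ C.normalCore.index ∈ C := fun x =>
    C.normalCore_le (Subgroup.pow_index_mem _ x)
  have := IsCyclic.isMulCommutative (α := C)
  refine ⟨C.normalCore.index, Nat.pos_of_ne_zero Subgroup.FiniteIndex.index_ne_zero, fun x y => ?_⟩
  exact congrArg Subtype.val (mul_comm' (⟨_, hmem x⟩ : C) ⟨_, hmem y⟩)

/-- Virtual cyclicity would impose the relation [xᴺ, yᴺ] = 1, of fixed length, on every generating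
triple, which large girth forbids. -/
theorem grigorchukGroup_not_isVirtuallyCyclic : ¬ IsVirtuallyCyclic grigorchukGroup := by
  intro h
  obtain ⟨N, hN, hcomm⟩ := h.exists_pow_commute
  set w : FreeGroup (Fin 3) := ⁅(FreeGroup.of (0 : Fin 3)) ^ N, (FreeGroup.of (1 : Fin 3)) ^ N⁆ with hw
  obtain ⟨x, -, hx⟩ := exists_generating_triple_noShortRelation w.norm
  refine freeGroup_commutator_pow_ne_one (i := (0 : Fin 3)) (j := 1) (by decide) hN (hx w le_rfl ?_)
  rw [hw, map_commutatorElement, commutatorElement_eq_one_iff_commute, map_pow, map_pow]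
  exact hcomm _ _

/-! ### Contraction of weighted words -/

/-- Weights of the generators. -/
def genWeight : GrigGen → ℕ
  | .a => 7
  | .b => 8
  | .c => 5
  | .d => 3

/-- The weight of a word. -/
def wordWeight (L : List GrigGen) : ℕ := (L.map genWeight).sum

/-- The permutation represented by a word. -/
noncomputable def wordPerm (L : List GrigGen) : Equiv.Perm (ℕ → Bool) := (L.map grigPerm).prod

@[simp]
theorem wordWeight_nil : wordWeight [] = 0 := rfl

@[simp]
theorem wordWeight_cons (s : GrigGen) (L : List GrigGen) :
    wordWeight (s :: L) = genWeight s + wordWeight L := by simp [wordWeight]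

@[simp]
theorem wordPerm_nil : wordPerm [] = 1 := rfl

@[simp]
theorem wordPerm_cons (s : GrigGen) (L : List GrigGen) :
    wordPerm (s :: L) = grigPerm s * wordPerm L := by simp [wordPerm]

theorem wordPerm_append (L M : List GrigGen) : wordPerm (L ++ M) = wordPerm L * wordPerm M := by
  simp [wordPerm]

theorem wordWeight_append (L M : List GrigGen) :
    wordWeight (L ++ M) = wordWeight L + wordWeight M := by simp [wordWeight]

theorem wordWeight_reverse (L : List GrigGen) : wordWeight L.reverse = wordWeight L := by
  simp [wordWeight, List.sum_reverse]

theorem wordPerm_reverse (L : List GrigGen) : wordPerm L.reverse = (wordPerm L)⁻¹ := by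
  induction L with
  | nil => simp
  | cons s L ih => simp [wordPerm_append, ih, grigPerm_inv]

theorem length_le_wordWeight (L : List GrigGen) : L.length ≤ wordWeight L := by
  induction L with
  | nil => simp
  | cons s L ih =>
    rw [List.length_cons, wordWeight_cons]
    have : 1 ≤ genWeight s := by cases s <;> simp [genWeight]
    omega

/-- The two words have the same value, and the first is at least as heavy. -/
def Shortens (L M : List GrigGen) : Prop := wordPerm M = wordPerm L ∧ wordWeight M ≤ wordWeight L

/-- Words in which `a` alternates with the other letters. -/
def IsAlternating (L : List GrigGen) : Prop := L.IsChain fun s t => s = .a ↔ t ≠ .a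

theorem exists_third_generator {s t : GrigGen} (hs : s ≠ .a) (ht : t ≠ .a) (hst : s ≠ t) :
    ∃ u, u ≠ .a ∧ grigPerm s * grigPerm t = grigPerm u ∧ genWeight u ≤ genWeight s + genWeight t := by
  cases s <;> cases t <;> first | exact absurd rfl hs | exact absurd rfl ht | exact absurd rfl hst | skip
  · exact ⟨.d, by simp, gB_mul_gC, by simp [genWeight]⟩
  · exact ⟨.c, by simp, gB_mul_gD, by simp [genWeight]⟩
  · exact ⟨.d, by simp, gC_mul_gB, by simp [genWeight]⟩
  · exact ⟨.b, by simp, gC_mul_gD, by simp [genWeight]⟩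
  · exact ⟨.c, by simp, gD_mul_gB, by simp [genWeight]⟩
  · exact ⟨.b, by simp, gD_mul_gC, by simp [genWeight]⟩

theorem exists_alternating (L : List GrigGen) : ∃ M, IsAlternating M ∧ Shortens L M := by
  induction L with
  | nil => exact ⟨[], List.isChain_nil, rfl, le_rfl⟩
  | cons s L ih =>
    obtain ⟨M, hM, h1, h2⟩ := ih
    have hsM : Shortens (s :: L) (s :: M) := by
      rw [Shortens, wordPerm_cons, wordPerm_cons, wordWeight_cons, wordWeight_cons, h1]
      exact ⟨rfl, by omega⟩
    cases M with
    | nil => exact ⟨[s], List.isChain_singleton s, hsM⟩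
    | cons t M =>
      by_cases hst : s = .a ↔ t ≠ .a
      · exact ⟨s :: t :: M, List.isChain_cons_cons.2 ⟨hst, hM⟩, hsM⟩
      by_cases heq : s = t
      · subst heq
        refine ⟨M, hM.tail, ?_, ?_⟩
        · rw [← hsM.1, wordPerm_cons, wordPerm_cons, ← mul_assoc, grigPerm_mul_self, one_mul]
        · have := hsM.2
          simp only [wordWeight_cons] at this ⊢
          omega
      · have hs : s ≠ .a := by rintro rfl; exact hst ⟨fun _ => Ne.symm heq, fun _ => rfl⟩
        have ht : t ≠ .a := by
          intro ht
          exact hst ⟨fun h => absurd h hs, fun h => absurd ht h⟩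
        obtain ⟨u, hu, hmul, hw⟩ := exists_third_generator hs ht heq
        refine ⟨u :: M, ?_, ?_, ?_⟩
        · cases M with
          | nil => exact List.isChain_singleton u
          | cons v M =>
            obtain ⟨h3, h4⟩ := List.isChain_cons_cons.1 hM
            refine List.isChain_cons_cons.2 ⟨⟨fun h => absurd h hu, fun h => absurd (h3.2 h) ht⟩, h4⟩
        · rw [← hsM.1, wordPerm_cons, wordPerm_cons, wordPerm_cons, ← mul_assoc, hmul]
        · have := hsM.2
          simp only [wordWeight_cons] at this ⊢
          omega

/-- The permutation with the given sections and the given action on the first letter. -/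
noncomputable def assemble (g h : Equiv.Perm (ℕ → Bool)) (ε : Bool) : Equiv.Perm (ℕ → Bool) :=
  pair g h * bif ε then gA else 1

theorem gA_mul_assemble (g h : Equiv.Perm (ℕ → Bool)) (ε : Bool) :
    gA * assemble g h ε = assemble h g (!ε) := by
  unfold assemble
  rw [← mul_assoc, gA_mul_pair, mul_assoc]
  cases ε <;> simp [gA_mul_self]

theorem pair_mul_assemble (g h g' h' : Equiv.Perm (ℕ → Bool)) (ε : Bool) :
    pair g h * assemble g' h' ε = assemble (g * g') (h * h') ε := by
  unfold assemble
  rw [← mul_assoc, pair_mul]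

/-- The weights 7, 8, 5, 3 are made for this: b, c, d each paired with one a weigh 15, 12, 10, while
their sections weigh 12, 10, 8, always at most 5/6. The identity 8 = 5 + 3 ensures that merging
neighbouring letters never adds weight. -/
theorem exists_sections_of_ne_a {s : GrigGen} (hs : s ≠ .a) : ∃ L M,
    grigPerm s = pair (wordPerm L) (wordPerm M) ∧
      6 * (wordWeight L + wordWeight M) ≤ 5 * (genWeight s + 7) := by
  cases s with
  | a => exact absurd rfl hs
  | b => exact ⟨[.a], [.c], by simpa using gB_eq, by simp [genWeight]⟩
  | c => exact ⟨[.a], [.d], by simpa using gC_eq, by simp [genWeight]⟩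
  | d => exact ⟨[], [.b], by simpa using gD_eq, by simp [genWeight]⟩

/-- Each letter other than a is paired with the a that follows it. At most one stays unpaired, so
the missing a costs at most 5·7 = 35. -/
theorem IsAlternating.exists_sections {L : List GrigGen} (hL : IsAlternating L) :
    ∃ M N ε, wordPerm L = assemble (wordPerm M) (wordPerm N) ε ∧
      6 * (wordWeight M + wordWeight N) ≤ 5 * wordWeight L + 35 ∧
      ((∀ s ∈ L.head?, s = .a) → 6 * (wordWeight M + wordWeight N) ≤ 5 * wordWeight L) := by
  induction L with
  | nil => exact ⟨[], [], false, by simp [assemble, pair_one], by simp, by simp⟩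
  | cons s L ih =>
    obtain ⟨M, N, ε, h1, h2, h3⟩ := ih hL.tail
    by_cases hs : s = .a
    · subst hs
      have h4 : 6 * (wordWeight N + wordWeight M) ≤ 5 * wordWeight (.a :: L) := by
        rw [wordWeight_cons, show genWeight .a = 7 from rfl]
        omega
      exact ⟨N, M, !ε, by rw [wordPerm_cons, h1, gA_mul_assemble], by omega, fun _ => h4⟩
    · obtain ⟨M', N', h4, h5⟩ := exists_sections_of_ne_a hs
      have h6 := h3 fun t ht => by
        cases L with
        | nil => simp at ht
        | cons u L =>
          rw [List.head?_cons, Option.mem_some_iff] at ht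
          subst ht
          by_contra hu
          exact hs ((List.isChain_cons_cons.1 hL).1.2 hu)
      refine ⟨M' ++ M, N' ++ N, ε, ?_, ?_, fun h => absurd (h s (by simp)) hs⟩
      · rw [wordPerm_cons, h1, h4, pair_mul_assemble, wordPerm_append, wordPerm_append]
      · simp only [wordWeight_append, wordWeight_cons]
        omega

/-! ### Subexponential growth -/

theorem finite_wordBall (r : ℕ) : {g | ∃ L, wordWeight L ≤ r ∧ wordPerm L = g}.Finite :=
  ((List.finite_length_le GrigGen r).image wordPerm).subset fun _ ⟨L, hL, h⟩ =>
    ⟨L, (length_le_wordWeight L).trans hL, h⟩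

/-- The permutations represented by words of weight at most `r`. -/
noncomputable def wordBall (r : ℕ) : Finset (Equiv.Perm (ℕ → Bool)) := (finite_wordBall r).toFinset

theorem mem_wordBall {r : ℕ} {g : Equiv.Perm (ℕ → Bool)} :
    g ∈ wordBall r ↔ ∃ L, wordWeight L ≤ r ∧ wordPerm L = g := by
  simp [wordBall]

/-- An element is determined by its two sections and one bit, and the sections share a total weight
of at most (5r + 35)/6. -/
theorem card_wordBall_le_sum (r : ℕ) : (wordBall r).card ≤
    2 * ∑ i ∈ Finset.range ((5 * r + 35) / 6 + 1),
      (wordBall i).card * (wordBall ((5 * r + 35) / 6 - i)).card := by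
  classical
  set s := (5 * r + 35) / 6 with hs
  have hsub : wordBall r ⊆ (Finset.range (s + 1)).biUnion fun i =>
      (wordBall i ×ˢ wordBall (s - i) ×ˢ Finset.univ).image fun p => assemble p.1 p.2.1 p.2.2 := by
    intro g hg
    obtain ⟨L, hL, rfl⟩ := mem_wordBall.1 hg
    obtain ⟨M, hM, h1, h2⟩ := exists_alternating L
    obtain ⟨M₀, M₁, ε, h3, h4, -⟩ := hM.exists_sections
    refine Finset.mem_biUnion.2 ⟨wordWeight M₀, Finset.mem_range.2 (by omega),
      Finset.mem_image.2 ⟨(wordPerm M₀, wordPerm M₁, ε), ?_, by rw [← h1, h3]⟩⟩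
    simp only [Finset.mem_product, Finset.mem_univ, and_true]
    exact ⟨mem_wordBall.2 ⟨M₀, le_rfl, rfl⟩, mem_wordBall.2 ⟨M₁, by omega, rfl⟩⟩
  refine (Finset.card_le_card hsub).trans (Finset.card_biUnion_le.trans ?_)
  rw [Finset.mul_sum]
  refine Finset.sum_le_sum fun i _ => Finset.card_image_le.trans ?_
  rw [Finset.card_product, Finset.card_product, Finset.card_univ, Fintype.card_bool]
  exact le_of_eq (by ring)

theorem card_wordBall_le_pow (r : ℕ) : (wordBall r).card ≤ 5 ^ r := by
  classical
  induction r with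
  | zero =>
    refine Finset.card_le_one.2 ?_
    have : ∀ g ∈ wordBall 0, g = 1 := by
      intro g hg
      obtain ⟨L, hL, rfl⟩ := mem_wordBall.1 hg
      rw [List.length_eq_zero_iff.1 (Nat.le_zero.1 ((length_le_wordWeight L).trans hL)), wordPerm_nil]
    exact fun g hg h hh => (this g hg).trans (this h hh).symm
  | succ r ih =>
    have hsub : wordBall (r + 1) ⊆ {1} ∪ (({gA, gB, gC, gD} : Finset _) ×ˢ wordBall r).image
        fun p => p.1 * p.2 := by
      intro g hg
      obtain ⟨L, hL, rfl⟩ := mem_wordBall.1 hg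
      cases L with
      | nil => simp
      | cons s L =>
        refine Finset.mem_union_right _ (Finset.mem_image.2 ⟨(grigPerm s, wordPerm L), ?_, by simp⟩)
        rw [wordWeight_cons] at hL
        have : 1 ≤ genWeight s := by cases s <;> simp [genWeight]
        exact Finset.mem_product.2 ⟨by cases s <;> simp, mem_wordBall.2 ⟨L, by omega, rfl⟩⟩
    have h4 : ({gA, gB, gC, gD} : Finset (Equiv.Perm (ℕ → Bool))).card ≤ 4 := Finset.card_le_four
    have h1 := (Finset.card_le_card hsub).trans (Finset.card_union_le _ _)
    have h2 := Finset.card_image_le (s := ({gA, gB, gC, gD} : Finset _) ×ˢ wordBall r)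
      (f := fun p : Equiv.Perm (ℕ → Bool) × Equiv.Perm (ℕ → Bool) => p.1 * p.2)
    rw [Finset.card_product] at h2
    have h3 := Nat.mul_le_mul h4 ih
    have h5 : 1 ≤ 5 ^ r := Nat.one_le_pow _ _ (by norm_num)
    rw [Finset.card_singleton] at h1
    rw [pow_succ]
    omega

/-- The number of permutations represented by words of weight at most `r` is `O(exp (t r))`. -/
def GrowthBound (t : ℝ) : Prop := ∃ C : ℝ, 0 < C ∧ ∀ r : ℕ, ((wordBall r).card : ℝ) ≤ C * Real.exp (t * r)

theorem growthBound_log_five : GrowthBound (Real.log 5) := by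
  refine ⟨1, one_pos, fun r => ?_⟩
  rw [one_mul, mul_comm, Real.exp_nat_mul, Real.exp_log (by norm_num)]
  exact_mod_cast card_wordBall_le_pow r

/-- The products of the two bounds give rate 5t/6; the linear number of summands is absorbed by an
additional rate t/12. -/
theorem GrowthBound.contract {t : ℝ} (ht : 0 < t) (h : GrowthBound t) :
    GrowthBound (11 / 12 * t) := by
  obtain ⟨C, hC, hle⟩ := h
  refine ⟨2 * C ^ 2 * Real.exp (6 * t) * (12 / t + 7), by positivity, fun r => ?_⟩
  set s := (5 * r + 35) / 6 with hs
  have hs1 : (s : ℝ) ≤ 5 / 6 * r + 6 := by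
    have : 6 * s ≤ 5 * r + 35 := by omega
    have : (6 * s : ℝ) ≤ 5 * r + 35 := by exact_mod_cast this
    linarith
  have h1 : ((wordBall r).card : ℝ) ≤ 2 * ∑ i ∈ Finset.range (s + 1), C ^ 2 * Real.exp (t * s) := by
    refine (Nat.cast_le.2 (card_wordBall_le_sum r)).trans ?_
    push_cast
    refine mul_le_mul_of_nonneg_left (Finset.sum_le_sum fun i hi => ?_) (by norm_num)
    have hi' : i ≤ s := Nat.lt_succ_iff.1 (Finset.mem_range.1 hi)
    refine (mul_le_mul (hle i) (hle _) (by positivity) (by positivity)).trans (le_of_eq ?_)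
    rw [mul_mul_mul_comm, ← Real.exp_add, ← hs, Nat.cast_sub hi', sq]
    ring_nf
  rw [Finset.sum_const, Finset.card_range, nsmul_eq_mul] at h1
  have h2 : ((s + 1 : ℕ) : ℝ) ≤ (12 / t + 7) * Real.exp (t / 12 * r) := by
    have e1 : t / 12 * r ≤ Real.exp (t / 12 * r) := by
      have := Real.add_one_le_exp (t / 12 * r)
      linarith
    have e2 : (1 : ℝ) ≤ Real.exp (t / 12 * r) := Real.one_le_exp (by positivity)
    have e3 : (r : ℝ) = 12 / t * (t / 12 * r) := by field_simp
    have e4 : 12 / t * (t / 12 * r) ≤ 12 / t * Real.exp (t / 12 * r) :=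
      mul_le_mul_of_nonneg_left e1 (by positivity)
    have e5 : (0 : ℝ) ≤ r := Nat.cast_nonneg r
    push_cast
    linarith
  have h3 : Real.exp (t * s) ≤ Real.exp (6 * t) * Real.exp (5 / 6 * t * r) := by
    rw [← Real.exp_add]
    refine Real.exp_le_exp.2 ?_
    have := mul_le_mul_of_nonneg_left hs1 ht.le
    linarith
  calc ((wordBall r).card : ℝ) ≤ 2 * (((s + 1 : ℕ) : ℝ) * (C ^ 2 * Real.exp (t * s))) := h1
    _ ≤ 2 * (((12 / t + 7) * Real.exp (t / 12 * r)) *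
        (C ^ 2 * (Real.exp (6 * t) * Real.exp (5 / 6 * t * r)))) := by gcongr
    _ = 2 * C ^ 2 * Real.exp (6 * t) * (12 / t + 7) *
        (Real.exp (t / 12 * r) * Real.exp (5 / 6 * t * r)) := by ring
    _ = _ := by
      rw [← Real.exp_add]
      ring_nf

theorem GrowthBound.mono {t u : ℝ} (h : GrowthBound t) (htu : t ≤ u) : GrowthBound u := by
  obtain ⟨C, hC, hle⟩ := h
  refine ⟨C, hC, fun r => (hle r).trans ?_⟩
  gcongr

theorem growthBound_of_pos {t : ℝ} (ht : 0 < t) : GrowthBound t := by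
  have h : ∀ n : ℕ, GrowthBound ((11 / 12) ^ n * Real.log 5) := by
    intro n
    induction n with
    | zero => simpa using growthBound_log_five
    | succ n ih =>
      have := ih.contract (mul_pos (by positivity) (Real.log_pos (by norm_num)))
      rwa [← mul_assoc, ← pow_succ'] at this
  have hlim : Tendsto (fun n : ℕ => (11 / 12 : ℝ) ^ n * Real.log 5) atTop (𝓝 0) := by
    simpa using (tendsto_pow_atTop_nhds_zero_of_lt_one (by norm_num)
      (by norm_num : (11 / 12 : ℝ) < 1)).mul_const (Real.log 5)
  obtain ⟨n, hn⟩ := (hlim.eventually (gt_mem_nhds ht)).exists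
  exact (h n).mono hn.le

theorem exists_wordPerm_eq {g : Equiv.Perm (ℕ → Bool)} (hg : g ∈ grigorchukGroup) :
    ∃ L, wordPerm L = g := by
  refine grig_induction (p := fun g => ∃ L, wordPerm L = g) ⟨[], rfl⟩ (fun s g _ ⟨L, hL⟩ => ?_) hg
  exact ⟨s :: L, by rw [wordPerm_cons, hL]⟩

/-- Balls of an arbitrary finite generating set are contained in balls of words. -/
theorem exists_growthFunction_le (S : Finset grigorchukGroup) :
    ∃ k, ∀ R, growthFunction S R ≤ (wordBall (k * R)).card := by
  choose W hW using fun g : grigorchukGroup => exists_wordPerm_eq g.2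
  set k := S.sup fun g => wordWeight (W g) with hk
  have hle : ∀ s : S, wordWeight (W s) ≤ k := fun s =>
    Finset.le_sup (f := fun g => wordWeight (W g)) s.2
  have key : ∀ L : List (S × Bool), ((pathEnd S L : grigorchukGroup) : Equiv.Perm (ℕ → Bool)) ∈
      wordBall (k * L.length) := by
    intro L
    induction L with
    | nil => exact mem_wordBall.2 ⟨[], by simp, by simp [pathEnd]⟩
    | cons p L ih =>
      obtain ⟨M, hM, h⟩ := mem_wordBall.1 ih
      rw [pathEnd, FreeGroup.lift_mk] at h ⊢
      rw [List.length_cons, mul_add, mul_one, List.map_cons, List.prod_cons, Subgroup.coe_mul, ← h]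
      obtain ⟨s, _ | _⟩ := p <;> have := hle s
      · refine mem_wordBall.2 ⟨(W s).reverse ++ M, ?_, ?_⟩
        · rw [wordWeight_append, wordWeight_reverse]
          omega
        · rw [wordPerm_append, wordPerm_reverse, hW]
          rfl
      · refine mem_wordBall.2 ⟨W s ++ M, ?_, ?_⟩
        · rw [wordWeight_append]
          omega
        · rw [wordPerm_append, hW]
          rfl
  refine ⟨k, fun R => ?_⟩
  rw [growthFunction, ← Set.ncard_image_of_injective _ Subtype.val_injective, ← Set.ncard_coe_finset]
  refine Set.ncard_le_ncard ?_ (Finset.finite_toSet _)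
  rintro _ ⟨_, ⟨L, hL, rfl⟩, rfl⟩
  obtain ⟨M, hM, h⟩ := mem_wordBall.1 (key L)
  exact mem_wordBall.2 ⟨M, hM.trans (Nat.mul_le_mul le_rfl hL), h⟩

theorem grigorchukGroup_not_hasExponentialGrowth : ¬ HasExponentialGrowth grigorchukGroup := by
  rintro ⟨S, -, rate, hrate, hlim⟩
  obtain ⟨k, hk⟩ := exists_growthFunction_le S
  have hlog : 0 < Real.log rate := Real.log_pos hrate
  -- Then t(k + 1) is half of log rate, so tk < log rate; using k + 1 avoids division by zero.
  set t := Real.log rate / (k + 1) / 2 with ht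
  have ht0 : 0 < t := by positivity
  obtain ⟨C, hC, hle⟩ := growthBound_of_pos ht0
  have hlim2 : Tendsto (fun R : ℕ => C ^ (1 / (R : ℝ)) * Real.exp (t * k)) atTop
      (𝓝 (1 * Real.exp (t * k))) := by
    refine Tendsto.mul_const _ ?_
    have h0 : Tendsto (fun R : ℕ => 1 / (R : ℝ)) atTop (𝓝 0) := tendsto_one_div_atTop_nhds_zero_nat
    have := (Real.continuousAt_const_rpow hC.ne' (b := 0)).tendsto.comp h0
    rwa [Real.rpow_zero] at this
  have hle2 : rate ≤ 1 * Real.exp (t * k) := by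
    refine le_of_tendsto_of_tendsto hlim hlim2 ?_
    filter_upwards [eventually_gt_atTop 0] with R hR
    have hR' : (R : ℝ) ≠ 0 := by positivity
    have h1 : (growthFunction S R : ℝ) ≤ C * Real.exp (t * k) ^ (R : ℝ) := by
      rw [← Real.exp_mul]
      refine (Nat.cast_le.2 (hk R)).trans ((hle _).trans (le_of_eq ?_))
      push_cast
      ring_nf
    calc (growthFunction S R : ℝ) ^ (1 / (R : ℝ)) ≤ (C * Real.exp (t * k) ^ (R : ℝ)) ^ (1 / (R : ℝ)) :=
          Real.rpow_le_rpow (by positivity) h1 (by positivity)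
      _ = C ^ (1 / (R : ℝ)) * Real.exp (t * k) := by
        rw [Real.mul_rpow hC.le (by positivity), ← Real.rpow_mul (Real.exp_pos _).le,
          mul_one_div_cancel hR', Real.rpow_one]
  rw [one_mul, ← Real.log_le_iff_le_exp (by linarith)] at hle2
  have h3 : t * (k + 1) = Real.log rate / 2 := by
    rw [ht]
    field_simp
  nlinarith

theorem mainTheorem3 :
    Preforms grigorchukGroup (FreeGroup (Fin 3)) ∧
    HasInfiniteGirth grigorchukGroup ∧
    ¬ HasExponentialGrowth grigorchukGroup ∧
    ¬ (∀ (Γ : Type) [Group Γ] [Group.FG Γ],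
        ¬ IsVirtuallyCyclic Γ → HasInfiniteGirth Γ → HasExponentialGrowth Γ) :=
  ⟨grigorchukGroup_preforms, grigorchukGroup_hasInfiniteGirth,
    grigorchukGroup_not_hasExponentialGrowth, fun h => grigorchukGroup_not_hasExponentialGrowth
      (h _ grigorchukGroup_not_isVirtuallyCyclic grigorchukGroup_hasInfiniteGirth)⟩
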